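/- **Setting.** There are $F$ files; file $f$ has size $S_f>0$, a cache has capacity $M$, and $U>0$ is the maximal number of users per period. A set $A$ of files is *feasible* if $\sum_{f\in A}S_f\le M$. For a profile $v\in\mathbb R_{\ge 0}^F$ let $r_v(A)=U\sum_{f\in A}S_fv_f$ and $r_{opt}(v)=\max\{r_v(A):A\text{ feasible}\}$. Passing from content $B$ to content $A$ costs $c(A,B)=\sum_{f\in A\setminus B}S_f$. The demand vectors $d^t=(d^t_f)_f$, $t\ge1$, are independent over time, and $d^t_f\in[0,1]$ has a law that does not depend on $t$, with unknown mean $\theta_f$; $\Theta=(\theta_f)_f$ and $r_{opt}=r_{opt}(\Theta)$. Let $0\le\alpha,\beta\le1$. An $(\alpha,\beta)$-*solver* is a randomized algorithm that for every profile $v\ge0$ outputs a feasible set $A$ such that $r_v(A)\ge\alpha\, r_{opt}(v)$ with probability at least $\beta$; its calls use independent random seeds, independent of the demands. **Algorithm (CUCBSC).** Let $n_1=F+1$ and $n_{j+1}=n_j+\Delta(j)$ with $\Delta(j)=\lceil\gamma\sqrt{n_j}\,\rceil$. The cache is initially empty, $\mathcal M^0=\emptyset$. In the periods $1,\dots,F$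 prescribed feasible sets are cached so that every file is cached at least once. In every period the demands of the cached files, and only these, are observed; $T_f$ is the number of periods in which $f$ was cached so far and $\hat\theta_f$ the mean of the demands observed for $f$. In the switching period $t=n_j$, $\mathcal M^{t}$ is the output of the $(\alpha,\beta)$-solver for the profile $\tilde\theta_f=\hat\theta_f+\sqrt{3\log t/(2T_f)}$; in the periods $n_j<t<n_{j+1}$ the content is not changed. **Regret.** For $w\ge0$, $$R(t)=\Big(t\alpha\beta\, r_{opt}-\mathbb E\sum_{i=1}^t r_\Theta(\mathcal M^i)\Big)+w\Big(\mathbb E\sum_{i=1}^t c(\mathcal M^i,\mathcal M^{i-1})-M\Big).$$ **Constants.** Let $\mathcal G$ and $\mathcal B$ be the sets of feasible $A$ with $r_\Theta(A)\ge\alpha r_{opt}$ and $r_\Theta(A)<\alpha r_{opt}$, respectively; assume $\mathcal B\ne\emptyset$. Put $\Delta_u=\alpha r_{opt}-\min_{\mathcal B}r_\Theta$, $\Delta_l=\alpha r_{opt}-\max_{\mathcal B}r_\Theta$, $M_u=\max\{c(A,B):A,B\text{ feasible}\}$ and $M_l=\max\{c(A,B):A,B\in\mathcal G\}$. Let $g$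 be any invertible linear function $\mathbb R\to\mathbb R$ such that $|r_v(A)-r_{v'}(A)|\le g(\Lambda)$ for all feasible $A$ and all $v,v'\in[0,1]^F$ with $\max_f|v_f-v'_f|\le\Lambda$. **Theorem.** If $2+\frac1{\sqrt{F+1}}\le\gamma\le\frac{F^2+F-1}{\sqrt{F+1}}$, then for all $t\ge1$ $$\begin{aligned}R(t)\le{}&\log t\Big[\tfrac{6}{(g^{-1}(\Delta_l))^2}\big(2Fw(M_u-M_l)+F\Delta_u\big)+w\tfrac{\gamma}{2}\cdot 2F(M_u-M_l)\Big]\\&+\sqrt t\,\big[wM_u+w(M_u-M_l)(1-2\beta)+F\Delta_u\gamma\big]+\Big(\tfrac{\pi^2}{3}+4.12\gamma+1\Big)F\Delta_u+wC,\end{aligned}$$ where $$C=F\Big(\tfrac{6F}{(g^{-1}(\Delta_l))^2}\cdot\tfrac{\log(F+1)}{\lceil\gamma\sqrt{F+1}\rceil}+1+\tfrac{\pi^2}{6}+\gamma+\tfrac{\pi^2/3+4.12\gamma}{\Delta(2)}-\tfrac1{\Delta(1)}\Big)\cdot2F(M_u-M_l)+FM_u-M_l .$$ In particular the regret is $O(\sqrt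 t)$: there is a constant $K$ with $R(t)\le K\sqrt t$ for all $t\ge1$. -/

import Mathlib

open MeasureTheory ProbabilityTheory

noncomputable section

/-- A cache placement problem with `F` files: file `f` has size `size f`, the cache has capacity
`cap`, and at most `users` users can be served per period. -/
structure CacheModel (F : ℕ) where
  size : Fin F → ℝ
  cap : ℝ
  users : ℝ
  size_pos : ∀ f, 0 < size f
  users_pos : 0 < users

namespace CacheModel

variable {F : ℕ} (m : CacheModel F)

/-- Cache contents that respect the capacity constraint. -/
def Feasible (A : Finset (Fin F)) : Prop := ∑ f ∈ A, m.size f ≤ m.cap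

/-- Expected one-period reward `r_v(A) = U ∑_{f ∈ A} S_f v_f` for the popularity profile `v`. -/
def reward (v : Fin F → ℝ) (A : Finset (Fin F)) : ℝ :=
  m.users * ∑ f ∈ A, m.size f * v f

/-- Cost of having content `A` when the preceding content was `B`. -/
def cost (A B : Finset (Fin F)) : ℝ := ∑ f ∈ A \ B, m.size f

/-- Value of the single-period optimization problem (a knapsack problem) for the profile `v`. -/
def opt (v : Fin F → ℝ) : ℝ := sSup (m.reward v '' {A | m.Feasible A})

/-- Good arm combinations. -/
def good (α : ℝ) (θ : Fin F → ℝ) : Set (Finset (Fin F)) :=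
  {A | m.Feasible A ∧ α * m.opt θ ≤ m.reward θ A}

/-- Bad arm combinations. -/
def bad (α : ℝ) (θ : Fin F → ℝ) : Set (Finset (Fin F)) :=
  {A | m.Feasible A ∧ m.reward θ A < α * m.opt θ}

/-- Largest gap `Δ_u` of a bad arm combination. -/
def gapU (α : ℝ) (θ : Fin F → ℝ) : ℝ := α * m.opt θ - sInf (m.reward θ '' m.bad α θ)

/-- Smallest gap `Δ_l` of a bad arm combination. -/
def gapL (α : ℝ) (θ : Fin F → ℝ) : ℝ := α * m.opt θ - sSup (m.reward θ '' m.bad α θ)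

/-- Maximal cost `M_u` of switching between two arm combinations. -/
def costU : ℝ := sSup {x | ∃ A B, m.Feasible A ∧ m.Feasible B ∧ x = m.cost A B}

/-- Maximal cost `M_l` of switching between two good arm combinations. -/
def costL (α : ℝ) (θ : Fin F → ℝ) : ℝ :=
  sSup {x | ∃ A ∈ m.good α θ, ∃ B ∈ m.good α θ, x = m.cost A B}

/-- The linear function `g` controls the variation of the expected reward with the profile. -/
def IsRewardModulus (g : ℝ ≃ₗ[ℝ] ℝ) : Prop :=
  ∀ A, m.Feasible A → ∀ v v' : Fin F → ℝ, v ∈ Set.Icc 0 1 → v' ∈ Set.Icc 0 1 →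
    ∀ Λ : ℝ, (∀ f, |v f - v' f| ≤ Λ) → |m.reward v A - m.reward v' A| ≤ g Λ

/-- A randomized algorithm `solve`, which reads a profile and a random seed of law `ν`, is an
`(α, β)`-solver: its output is feasible, and for every profile it attains, with probability at
least `β`, at least `α` times the optimal reward. -/
structure IsSolver {Seed : Type*} [MeasurableSpace Seed] (α β : ℝ) (ν : Measure Seed)
    (solve : (Fin F → ℝ) → Seed → Finset (Fin F)) : Prop where
  measurable : ∀ A, MeasurableSet {p : (Fin F → ℝ) × Seed | solve p.1 p.2 = A}
  feasible : ∀ v, 0 ≤ v → ∀ u, m.Feasible (solve v u)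
  success : ∀ v, 0 ≤ v → ENNReal.ofReal β ≤ ν {u | α * m.opt v ≤ m.reward v (solve v u)}

/-- `init 1, …, init F` are contents for the initialization: together they contain every file. -/
def IsInit (init : ℕ → Finset (Fin F)) : Prop :=
  (∀ t ∈ Finset.Icc 1 F, m.Feasible (init t)) ∧ ∀ f, ∃ t ∈ Finset.Icc 1 F, f ∈ init t

end CacheModel

/-- Length `⌈γ √n⌉` of a block that starts with a switching period `n`. -/
def blockLen (γ : ℝ) (n : ℕ) : ℕ := ⌈γ * √(n : ℝ)⌉₊

/-- The switching periods; `switchTime F γ j` is the `(j+1)`-st one, the first one is `F + 1`. -/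
def switchTime (F : ℕ) (γ : ℝ) : ℕ → ℕ
  | 0 => F + 1
  | j + 1 => switchTime F γ j + blockLen γ (switchTime F γ j)

/-- Memory of the CUCBSC algorithm at the end of a period: the cache content in that period, the
number of times each file has been cached so far, and the sample means of the observed demands. -/
structure CucbState (F : ℕ) where
  cache : Finset (Fin F)
  plays : Fin F → ℕ
  mean : Fin F → ℝ

namespace CucbState

variable {F : ℕ}

/-- Perturbed estimates used in the switching period `t`. -/
def perturbed (s : CucbState F) (t : ℕ) (f : Fin F) : ℝ :=
  s.mean f + √(3 * Real.log t / (2 * s.plays f))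

/-- Cache content `A`, then observe the demands `x f` for `f ∈ A` only. (The demand of a cached
file is its reward divided by `U S_f`.) -/
def play (s : CucbState F) (A : Finset (Fin F)) (x : Fin F → ℝ) : CucbState F where
  cache := A
  plays f := if f ∈ A then s.plays f + 1 else s.plays f
  mean f := if f ∈ A then (s.mean f * s.plays f + x f) / (s.plays f + 1) else s.mean f

end CucbState

open Classical in
/-- The run of CUCBSC with switching periods `n 0 < n 1 < …`, where `x t` is the vector of demands
in period `t` and `u t` is the random seed that the solver reads if it is called in period `t`. -/
def cucbsc {F : ℕ} {Seed : Type*} (n : ℕ → ℕ) (init : ℕ → Finset (Fin F))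
    (solve : (Fin F → ℝ) → Seed → Finset (Fin F)) (x : ℕ → Fin F → ℝ) (u : ℕ → Seed) :
    ℕ → CucbState F
  | 0 => ⟨∅, fun _ => 0, fun _ => 0⟩
  | t + 1 =>
    let s := cucbsc n init solve x u t
    let A :=
      if t + 1 ≤ F then init (t + 1)
      else if ∃ j, n j = t + 1 then solve (s.perturbed (t + 1)) (u (t + 1))
      else s.cache
    s.play A (x (t + 1))

/-- The standing assumptions on the randomness. The demand vectors `d t` are independent over time,
the demand for file `f` lies in `[0, 1]`, has a law that does not depend on time, and has mean
`θ f`; the seeds of the solver are iid of law `ν`, and independent of the demands. -/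
structure IsEnvironment {F : ℕ} {Ω Seed : Type*} [MeasurableSpace Ω] [MeasurableSpace Seed]
    (P : Measure Ω) (ν : Measure Seed) (θ : Fin F → ℝ)
    (d : ℕ → Ω → Fin F → ℝ) (ξ : ℕ → Ω → Seed) : Prop where
  measurable_demand : ∀ t, Measurable (d t)
  demand_mem : ∀ t f, ∀ᵐ ω ∂P, d t ω f ∈ Set.Icc (0 : ℝ) 1
  demand_ident : ∀ t f, IdentDistrib (fun ω => d t ω f) (fun ω => d 0 ω f) P P
  demand_mean : ∀ t f, ∫ ω, d t ω f ∂P = θ f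
  demand_indep : iIndepFun d P
  measurable_seed : ∀ t, Measurable (ξ t)
  seed_law : ∀ t, P.map (ξ t) = ν
  seed_indep : iIndepFun ξ P
  indep : IndepFun (fun ω t => d t ω) (fun ω t => ξ t ω) P

section Regret

variable {F : ℕ} {Ω : Type*} [MeasurableSpace Ω] (m : CacheModel F) (P : Measure Ω)
  (θ : Fin F → ℝ) (α β : ℝ) (𝓜 : ℕ → Ω → Finset (Fin F))

/-- Sampling regret until period `t` of a policy whose content in period `i` is `𝓜 i`. -/
def samplingRegret (t : ℕ) : ℝ :=
  t * α * β * m.opt θ - ∫ ω, ∑ i ∈ Finset.Icc 1 t, m.reward θ (𝓜 i ω) ∂P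

/-- Switching regret until period `t`. -/
def switchingRegret (t : ℕ) : ℝ :=
  (∫ ω, ∑ i ∈ Finset.Icc 1 t, m.cost (𝓜 i ω) (𝓜 (i - 1) ω) ∂P) - m.cap

/-- Regret with switching cost until period `t`. -/
def regret (w : ℝ) (t : ℕ) : ℝ :=
  samplingRegret m P θ α β 𝓜 t + w * switchingRegret m P 𝓜 t

end Regret

/-- The constant `C` of the regret bound; here `gi` stands for `g⁻¹(Δ_l)`. -/
def regretConst (F : ℕ) (γ gi Mu Ml : ℝ) : ℝ :=
  F * (6 * F / gi ^ 2 * (Real.log (F + 1) / blockLen γ (F + 1)) + 1 + Real.pi ^ 2 / 6 + γ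
      + (Real.pi ^ 2 / 3 + 4.12 * γ) / blockLen γ (switchTime F γ 1)
      - 1 / blockLen γ (switchTime F γ 0)) * (2 * F * (Mu - Ml))
    + F * Mu - Ml

end

/-! A block starting at period `n` has length about `γ√n`. Hence at most `√t` blocks start up to
time `t`, while the current block is no longer than about `γ√t`. The first fact controls the
switching cost and the second the reward lost in the last badly chosen block. Both give `√t`; all
other losses are logarithmic or bounded.

Let `p j` be the probability that in the switching period of block `j` the solver succeeds for the
perturbed profile and its content is nevertheless bad for `θ`. Each period of the block has expected
loss at most `Δ_u * p j` against `αβ r_opt`, so the sampling regret is governed by the sum of the `p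
j` weighted by block lengths (`IsEnvironment.samplingRegret_le_sum`). A switch costs at most `M_l`
between good contents and `M_u` otherwise, and a content is bad with probability at most `p j + 1 -
β`; so the switching regret is governed by the unweighted sum
(`IsEnvironment.switchingRegret_le_sum`).

Now suppose that all sample means are within their confidence radii. Then the perturbed profile
dominates `θ` and exceeds it by less than two radii. By `CacheModel.not_bad_of_close`, a successful
but bad content must contain a file observed at most `ℓ = 6 log t / g⁻¹(Δ_l)²` times. The confidence
bounds fail at period `n` with probability at most `2F/n²`. Since the algorithm itself decides which
demands it observes, this rests on an exponential supermartingale with optional skipping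
(`lintegral_exp_skipping_le_one`) and a union over the number of observations. The failures are
summable because `n_j ≥ (j+1)²`.

The rarely observed files are treated pathwise. Every block charged to such a file raises its
counter by the whole block length, so the charges to one file total at most `ℓ` plus one last block
(`sum_le_of_counters`). Actual block lengths as weights give the sampling bound; the constant weight
`Δ(1)`, divided out afterwards, gives the switching bound. -/

namespace CacheModel

/-! ### Rewards, gaps and switching costs of the cache model. -/

variable {F : ℕ} (m : CacheModel F)

lemma Feasible.mono {m : CacheModel F} {A B : Finset (Fin F)} (hB : m.Feasible B) (h : A ⊆ B) :
    m.Feasible A :=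
  (Finset.sum_le_sum_of_subset_of_nonneg h fun f _ _ => (m.size_pos f).le).trans hB

lemma reward_nonneg {v : Fin F → ℝ} (hv : 0 ≤ v) (A : Finset (Fin F)) : 0 ≤ m.reward v A :=
  mul_nonneg m.users_pos.le (Finset.sum_nonneg fun f _ => mul_nonneg (m.size_pos f).le (hv f))

lemma reward_mono {v v' : Fin F → ℝ} (h : v ≤ v') (A : Finset (Fin F)) :
    m.reward v A ≤ m.reward v' A :=
  mul_le_mul_of_nonneg_left
    (Finset.sum_le_sum fun f _ => mul_le_mul_of_nonneg_left (h f) (m.size_pos f).le)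
    m.users_pos.le

lemma reward_le_opt (v : Fin F → ℝ) {A : Finset (Fin F)} (hA : m.Feasible A) :
    m.reward v A ≤ m.opt v :=
  le_csSup ((Set.toFinite _).image _).bddAbove ⟨A, hA, rfl⟩

lemma exists_reward_eq_opt (h : m.Feasible ∅) (v : Fin F → ℝ) :
    ∃ A, m.Feasible A ∧ m.reward v A = m.opt v := by
  have hne : (m.reward v '' {A | m.Feasible A}).Nonempty := ⟨_, ∅, h, rfl⟩
  obtain ⟨A, hA, h'⟩ := hne.csSup_mem ((Set.toFinite {A | m.Feasible A}).image _)
  exact ⟨A, hA, h'⟩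

/-- The maximum is attained, so comparison with it is a finite conjunction. In this form the success
of the solver is visibly a measurable event. -/
lemma mul_opt_le_iff (h : m.Feasible ∅) {α : ℝ} (hα : 0 ≤ α) (v : Fin F → ℝ) (y : ℝ) :
    α * m.opt v ≤ y ↔ ∀ B, m.Feasible B → α * m.reward v B ≤ y := by
  constructor
  · intro h' B hB
    exact (mul_le_mul_of_nonneg_left (m.reward_le_opt v hB) hα).trans h'
  · intro h'
    obtain ⟨A, hA, e⟩ := m.exists_reward_eq_opt h v
    exact e ▸ h' A hA

lemma opt_mono (h : m.Feasible ∅) {v v' : Fin F → ℝ} (hv : v ≤ v') : m.opt v ≤ m.opt v' := by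
  obtain ⟨A, hA, e⟩ := m.exists_reward_eq_opt h v
  rw [← e]
  exact (m.reward_mono hv A).trans (m.reward_le_opt v' hA)

lemma opt_nonneg (h : m.Feasible ∅) {v : Fin F → ℝ} (hv : 0 ≤ v) : 0 ≤ m.opt v :=
  (m.reward_nonneg hv ∅).trans (m.reward_le_opt v h)

lemma le_reward_of_bad {α : ℝ} {θ : Fin F → ℝ} {A : Finset (Fin F)} (hA : A ∈ m.bad α θ) :
    α * m.opt θ - m.gapU α θ ≤ m.reward θ A := by
  have : sInf (m.reward θ '' m.bad α θ) ≤ m.reward θ A :=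
    csInf_le ((Set.toFinite _).image _).bddBelow ⟨A, hA, rfl⟩
  unfold gapU
  linarith

lemma reward_le_of_bad {α : ℝ} {θ : Fin F → ℝ} {A : Finset (Fin F)} (hA : A ∈ m.bad α θ) :
    m.reward θ A ≤ α * m.opt θ - m.gapL α θ := by
  have : m.reward θ A ≤ sSup (m.reward θ '' m.bad α θ) :=
    le_csSup ((Set.toFinite _).image _).bddAbove ⟨A, hA, rfl⟩
  unfold gapL
  linarith

lemma gapL_pos {α : ℝ} {θ : Fin F → ℝ} (h : (m.bad α θ).Nonempty) : 0 < m.gapL α θ := by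
  obtain ⟨A, hA, e⟩ := (h.image (m.reward θ)).csSup_mem ((Set.toFinite (m.bad α θ)).image _)
  have := hA.2
  unfold gapL
  linarith

lemma gapU_pos {α : ℝ} {θ : Fin F → ℝ} (h : (m.bad α θ).Nonempty) : 0 < m.gapU α θ := by
  obtain ⟨A, hA⟩ := h
  have h1 := m.le_reward_of_bad hA
  have := hA.2
  linarith

lemma cost_nonneg (A B : Finset (Fin F)) : 0 ≤ m.cost A B :=
  Finset.sum_nonneg fun f _ => (m.size_pos f).le

lemma cost_self (A : Finset (Fin F)) : m.cost A A = 0 := by simp [cost]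

lemma cost_le_costU {A B : Finset (Fin F)} (hA : m.Feasible A) (hB : m.Feasible B) :
    m.cost A B ≤ m.costU := by
  refine le_csSup (Set.Finite.bddAbove ?_) ⟨A, B, hA, hB, rfl⟩
  refine (Set.finite_range fun p : Finset (Fin F) × Finset (Fin F) => m.cost p.1 p.2).subset ?_
  rintro x ⟨A, B, -, -, rfl⟩
  exact ⟨(A, B), rfl⟩

lemma costU_le_cap (h : m.Feasible ∅) : m.costU ≤ m.cap := by
  refine csSup_le ⟨_, ∅, ∅, h, h, rfl⟩ ?_
  rintro x ⟨A, B, hA, -, rfl⟩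
  exact hA.mono Finset.sdiff_subset

lemma cost_le_costL {α : ℝ} {θ : Fin F → ℝ} {A B : Finset (Fin F)} (hA : A ∈ m.good α θ)
    (hB : B ∈ m.good α θ) : m.cost A B ≤ m.costL α θ := by
  refine le_csSup (Set.Finite.bddAbove ?_) ⟨A, hA, B, hB, rfl⟩
  refine (Set.finite_range fun p : Finset (Fin F) × Finset (Fin F) => m.cost p.1 p.2).subset ?_
  rintro x ⟨A, -, B, -, rfl⟩
  exact ⟨(A, B), rfl⟩

lemma costL_nonneg (α : ℝ) (θ : Fin F → ℝ) : 0 ≤ m.costL α θ := by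
  apply Real.sSup_nonneg
  rintro x ⟨A, -, B, -, rfl⟩
  exact m.cost_nonneg A B

lemma costU_nonneg : 0 ≤ m.costU := by
  apply Real.sSup_nonneg
  rintro x ⟨A, B, -, -, rfl⟩
  exact m.cost_nonneg A B

lemma costL_le_costU (α : ℝ) (θ : Fin F → ℝ) : m.costL α θ ≤ m.costU := by
  apply Real.sSup_le _ m.costU_nonneg
  rintro x ⟨A, hA, B, hB, rfl⟩
  exact m.cost_le_costU hA.1 hB.1

/-- Comparing the profiles `1` and `0` extracts from the modulus the only constant that is needed.
Perturbed estimates can exceed `1`, so the modulus cannot be applied to them directly; linearity of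
the reward in the profile does the rest. -/
lemma IsRewardModulus.users_mul_sum_size_le {m : CacheModel F} {g : ℝ ≃ₗ[ℝ] ℝ}
    (hg : m.IsRewardModulus g) {A : Finset (Fin F)} (hA : m.Feasible A) :
    m.users * ∑ f ∈ A, m.size f ≤ g 1 := by
  have := hg A hA 1 0 (by simp) (by simp) 1 (by simp)
  refine le_trans ?_ this
  simpa [reward] using le_abs_self (m.users * ∑ f ∈ A, m.size f)

lemma _root_.LinearEquiv.symm_apply_eq_div (g : ℝ ≃ₗ[ℝ] ℝ) (y : ℝ) : g.symm y = y / g 1 := by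
  have h1 : g 1 ≠ 0 := by simp
  rw [eq_div_iff h1, mul_comm]
  have : g (g.symm y • (1 : ℝ)) = g.symm y • g 1 := map_smul _ _ _
  simp only [smul_eq_mul, mul_one, LinearEquiv.apply_symm_apply] at this
  rw [mul_comm]
  exact this.symm

/-- If the perturbed profile `v` dominates `θ`, and exceeds it by less than `g⁻¹(Δ_l)` on the
files of `A`, then a content `A` that is `α`-optimal for `v` is not bad for `θ`. -/
lemma not_bad_of_close {m : CacheModel F} {g : ℝ ≃ₗ[ℝ] ℝ} (hg : m.IsRewardModulus g)
    {α : ℝ} (hα : 0 ≤ α) {θ v : Fin F → ℝ} (hθv : θ ≤ v) {A : Finset (Fin F)}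
    (hclose : ∀ f ∈ A, v f - θ f < g.symm (m.gapL α θ))
    (hA : α * m.opt v ≤ m.reward v A) : A ∉ m.bad α θ := by
  intro hbad
  have hemp : m.Feasible ∅ := hbad.1.mono (Finset.empty_subset _)
  have hopt := mul_le_mul_of_nonneg_left (m.opt_mono hemp hθv) hα
  rcases A.eq_empty_or_nonempty with rfl | hne
  -- The empty content has reward `0` under every profile; it is treated apart because the strict
  -- inequality below needs a nonempty sum.
  · have h1 := hbad.2
    have : m.reward v ∅ = m.reward θ ∅ := by simp [reward]
    linarith
  · have hpos : 0 < m.users * ∑ f ∈ A, m.size f :=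
      mul_pos m.users_pos (Finset.sum_pos (fun f _ => m.size_pos f) hne)
    have hk := hg.users_mul_sum_size_le hbad.1
    have hlt : m.reward v A - m.reward θ A < m.users * ∑ f ∈ A, m.size f * g.symm (m.gapL α θ) := by
      have : m.reward v A - m.reward θ A = m.users * ∑ f ∈ A, m.size f * (v f - θ f) := by
        simp only [reward, mul_sub, Finset.sum_sub_distrib]
      rw [this]
      exact mul_lt_mul_of_pos_left (Finset.sum_lt_sum_of_nonempty hne fun f hf =>
        mul_lt_mul_of_pos_left (hclose f hf) (m.size_pos f)) m.users_pos
    have hgap := m.gapL_pos ⟨A, hbad⟩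
    have h3 : m.users * ∑ f ∈ A, m.size f * g.symm (m.gapL α θ) ≤ m.gapL α θ := by
      rw [← Finset.sum_mul, g.symm_apply_eq_div, ← mul_assoc, ← mul_div_assoc,
        div_le_iff₀ (hpos.trans_le hk), mul_comm]
      exact mul_le_mul_of_nonneg_left hk hgap.le
    have := m.reward_le_of_bad hbad
    linarith

end CacheModel

/-! ### Growth of the switching times and decomposition into blocks. -/

lemma le_blockLen (γ : ℝ) (n : ℕ) : γ * √(n : ℝ) ≤ blockLen γ n := Nat.le_ceil _

lemma blockLen_le {γ : ℝ} (hγ : 0 ≤ γ) (n : ℕ) : (blockLen γ n : ℝ) ≤ γ * √(n : ℝ) + 1 :=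
  (Nat.ceil_lt_add_one (by positivity)).le

lemma blockLen_mono {γ : ℝ} (hγ : 0 ≤ γ) : Monotone (blockLen γ) := fun a b h =>
  Nat.ceil_mono (mul_le_mul_of_nonneg_left (Real.sqrt_le_sqrt (by exact_mod_cast h)) hγ)

lemma le_switchTime (F : ℕ) (γ : ℝ) (j : ℕ) : F + 1 ≤ switchTime F γ j := by
  induction j with
  | zero => exact le_rfl
  | succ j ih => exact ih.trans (Nat.le_add_right _ _)

lemma blockLen_switchTime_pos {F : ℕ} {γ : ℝ} (hγ : 0 < γ) (j : ℕ) :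
    0 < blockLen γ (switchTime F γ j) := by
  have := le_switchTime F γ j
  refine Nat.ceil_pos.2 (mul_pos hγ (Real.sqrt_pos.2 ?_))
  exact_mod_cast (by omega : 0 < switchTime F γ j)

lemma switchTime_strictMono (F : ℕ) {γ : ℝ} (hγ : 0 < γ) : StrictMono (switchTime F γ) :=
  strictMono_nat_of_lt_succ fun j => Nat.lt_add_of_pos_right (blockLen_switchTime_pos hγ j)

/-- With `s = √n_j ≥ √(F+1)`, the lower bound on `γ` gives `s² + γs ≥ s² + 2s + 1 = (s+1)²`; so the
square root gains at least one per block. This is what limits the number of blocks and makes the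
confidence failures summable. -/
lemma sqrt_switchTime_ge {F : ℕ} {γ : ℝ} (hγ : 2 + 1 / √((F : ℝ) + 1) ≤ γ) (j : ℕ) :
    √((F : ℝ) + 1) + j ≤ √(switchTime F γ j : ℝ) := by
  induction j with
  | zero => simp [switchTime]
  | succ j ih =>
    have h1 : (1 : ℝ) ≤ √((F : ℝ) + 1) := Real.one_le_sqrt.2 (by simp)
    set s := √(switchTime F γ j : ℝ) with hs
    have hsq : s ^ 2 = switchTime F γ j := Real.sq_sqrt (Nat.cast_nonneg _)
    have hge : √((F : ℝ) + 1) ≤ s := le_trans (by simp) ih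
    have h2 : s + 1 ≤ √(switchTime F γ (j + 1) : ℝ) := by
      apply Real.le_sqrt_of_sq_le
      have h3 : γ * s ≤ blockLen γ (switchTime F γ j) := le_blockLen _ _
      have h4 : (2 + 1 / √((F : ℝ) + 1)) * s ≤ γ * s :=
        mul_le_mul_of_nonneg_right hγ (by linarith)
      have h5 : 1 ≤ 1 / √((F : ℝ) + 1) * s := by
        rw [one_div, inv_mul_eq_div, one_le_div (by linarith)]
        exact hge
      simp only [switchTime, Nat.cast_add]
      nlinarith
    push_cast
    linarith

lemma exists_switchTime_le_lt {F : ℕ} {γ : ℝ} (hγ : 0 < γ) {t : ℕ} (ht : F + 1 ≤ t) :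
    ∃ j, switchTime F γ j ≤ t ∧ t < switchTime F γ (j + 1) := by
  have hmono := switchTime_strictMono F hγ
  have hex : ∃ k, t < switchTime F γ k := ⟨t + 1, (Nat.lt_succ_self t).trans_le (hmono.le_apply)⟩
  have h0 : Nat.find hex ≠ 0 := fun h0 => by
    have := Nat.find_spec hex
    rw [h0] at this
    exact absurd ht (by simpa [switchTime] using this)
  obtain ⟨j, hj⟩ := Nat.exists_eq_succ_of_ne_zero h0
  refine ⟨j, ?_, ?_⟩
  · exact not_lt.1 (Nat.find_min hex (by omega))
  · have := Nat.find_spec hex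
    rwa [hj] at this

lemma not_switchTime_of_between {F : ℕ} {γ : ℝ} (hγ : 0 < γ) {j t : ℕ}
    (h1 : switchTime F γ j < t) (h2 : t < switchTime F γ (j + 1)) (k : ℕ) :
    switchTime F γ k ≠ t := by
  rintro rfl
  have hmono := switchTime_strictMono F hγ
  rw [hmono.lt_iff_lt] at h1 h2
  omega

/-- A sum over the periods of the first `J` blocks is a sum of block sums. -/
lemma sum_Ico_switchTime {F : ℕ} {γ : ℝ} (hγ : 0 < γ) (h : ℕ → ℝ) (J : ℕ) :
    ∑ i ∈ Finset.Ico (F + 1) (switchTime F γ J), h i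
      = ∑ j ∈ Finset.range J, ∑ i ∈ Finset.Ico (switchTime F γ j) (switchTime F γ (j + 1)), h i := by
  induction J with
  | zero => simp [switchTime]
  | succ J ih =>
    rw [Finset.sum_range_succ, ← ih, Finset.sum_Ico_consecutive _ (le_switchTime F γ J)
      ((switchTime_strictMono F hγ).monotone (Nat.le_succ J))]

/-! ### Pathwise behaviour of the algorithm. -/

section Run

variable {F : ℕ} {Seed : Type*} (n : ℕ → ℕ) (init : ℕ → Finset (Fin F))
  (solve : (Fin F → ℝ) → Seed → Finset (Fin F)) (x : ℕ → Fin F → ℝ) (u : ℕ → Seed)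

open Classical in
lemma cucbsc_cache_succ (t : ℕ) : (cucbsc n init solve x u (t + 1)).cache =
    if t + 1 ≤ F then init (t + 1)
    else if ∃ j, n j = t + 1 then
      solve ((cucbsc n init solve x u t).perturbed (t + 1)) (u (t + 1))
    else (cucbsc n init solve x u t).cache := rfl

lemma cucbsc_plays_succ (t : ℕ) (f : Fin F) : (cucbsc n init solve x u (t + 1)).plays f =
    (cucbsc n init solve x u t).plays f
      + if f ∈ (cucbsc n init solve x u (t + 1)).cache then 1 else 0 := by
  have : (cucbsc n init solve x u (t + 1)).plays f =
    if f ∈ (cucbsc n init solve x u (t + 1)).cache then (cucbsc n init solve x u t).plays f + 1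
    else (cucbsc n init solve x u t).plays f := rfl
  rw [this]
  split_ifs <;> rfl

lemma cucbsc_mean_succ (t : ℕ) (f : Fin F) : (cucbsc n init solve x u (t + 1)).mean f =
    if f ∈ (cucbsc n init solve x u (t + 1)).cache then
      ((cucbsc n init solve x u t).mean f * (cucbsc n init solve x u t).plays f + x (t + 1) f)
        / ((cucbsc n init solve x u t).plays f + 1)
    else (cucbsc n init solve x u t).mean f := rfl

lemma cucbsc_plays_eq (t : ℕ) (f : Fin F) : ((cucbsc n init solve x u t).plays f : ℝ) =
    ∑ i ∈ Finset.range t, if f ∈ (cucbsc n init solve x u (i + 1)).cache then 1 else 0 := by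
  induction t with
  | zero => simp [cucbsc]
  | succ t ih =>
    rw [Finset.sum_range_succ, ← ih, cucbsc_plays_succ]
    push_cast
    rfl

/-- Multiplying by the counter turns the recursive mean into a plain sum over observed demands, also
when the file has not been cached yet. -/
lemma cucbsc_mean_mul_plays (t : ℕ) (f : Fin F) :
    (cucbsc n init solve x u t).mean f * (cucbsc n init solve x u t).plays f =
    ∑ i ∈ Finset.range t,
      if f ∈ (cucbsc n init solve x u (i + 1)).cache then x (i + 1) f else 0 := by
  induction t with
  | zero => simp [cucbsc]
  | succ t ih =>
    rw [Finset.sum_range_succ, ← ih, cucbsc_plays_succ, cucbsc_mean_succ]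
    split_ifs with h
    · push_cast
      rw [div_mul_cancel₀]
      positivity
    · simp

lemma cucbsc_plays_mono (f : Fin F) : Monotone fun t => (cucbsc n init solve x u t).plays f :=
  monotone_nat_of_le_succ fun t => by
    rw [cucbsc_plays_succ]
    exact Nat.le_add_right _ _

lemma cucbsc_plays_le (t : ℕ) (f : Fin F) : (cucbsc n init solve x u t).plays f ≤ t := by
  induction t with
  | zero => simp [cucbsc]
  | succ t ih =>
    rw [cucbsc_plays_succ]
    split_ifs <;> omega

lemma cucbsc_cache_of_le {t : ℕ} (h1 : 1 ≤ t) (hF : t ≤ F) :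
    (cucbsc n init solve x u t).cache = init t := by
  obtain ⟨t, rfl⟩ := Nat.exists_eq_succ_of_ne_zero (by omega : t ≠ 0)
  rw [Nat.succ_eq_add_one, cucbsc_cache_succ, if_pos hF]

lemma cucbsc_plays_pos {m : CacheModel F} (hinit : m.IsInit init) {t : ℕ} (ht : F ≤ t)
    (f : Fin F) : 0 < (cucbsc n init solve x u t).plays f := by
  obtain ⟨s, hs, hf⟩ := hinit.2 f
  rw [Finset.mem_Icc] at hs
  refine lt_of_lt_of_le ?_ (cucbsc_plays_mono n init solve x u f (hs.2.trans ht))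
  obtain ⟨s, rfl⟩ := Nat.exists_eq_succ_of_ne_zero (by omega : s ≠ 0)
  simp only [Nat.succ_eq_add_one] at hs hf ⊢
  rw [cucbsc_plays_succ, cucbsc_cache_of_le n init solve x u hs.1 hs.2, if_pos hf]
  omega

lemma cucbsc_mean_nonneg (hx : ∀ t, 0 ≤ x t) (t : ℕ) (f : Fin F) :
    0 ≤ (cucbsc n init solve x u t).mean f := by
  induction t with
  | zero => simp [cucbsc]
  | succ t ih =>
    rw [cucbsc_mean_succ]
    have := hx (t + 1) f
    split_ifs
    · simp only [Pi.zero_apply] at this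
      positivity
    · exact ih

lemma cucbsc_perturbed_nonneg (hx : ∀ t, 0 ≤ x t) (t s : ℕ) :
    0 ≤ (cucbsc n init solve x u t).perturbed s := fun f =>
  add_nonneg (cucbsc_mean_nonneg n init solve x u hx t f) (Real.sqrt_nonneg _)

lemma cucbsc_feasible {m : CacheModel F} (hinit : m.IsInit init) (hemp : m.Feasible ∅)
    (hsolve : ∀ v, 0 ≤ v → ∀ u, m.Feasible (solve v u)) (hx : ∀ t, 0 ≤ x t) (t : ℕ) :
    m.Feasible (cucbsc n init solve x u t).cache := by
  induction t with
  | zero => exact hemp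
  | succ t ih =>
    rw [cucbsc_cache_succ]
    split_ifs with h1 h2
    · exact hinit.1 _ (Finset.mem_Icc.2 ⟨by omega, h1⟩)
    · exact hsolve _ (cucbsc_perturbed_nonneg n init solve x u hx _ _) _
    · exact ih

variable {γ : ℝ}

lemma cucbsc_cache_block (hγ : 0 < γ) {j t : ℕ} (h1 : switchTime F γ j ≤ t) (h2 : t < switchTime F γ (j + 1)) :
    (cucbsc (switchTime F γ) init solve x u t).cache
      = (cucbsc (switchTime F γ) init solve x u (switchTime F γ j)).cache := by
  induction t, h1 using Nat.le_induction with
  | base => rfl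
  | succ t h1 ih =>
    have hF := le_switchTime F γ j
    rw [cucbsc_cache_succ, if_neg (by omega), if_neg, ih (by omega)]
    rintro ⟨k, hk⟩
    exact not_switchTime_of_between hγ (Nat.lt_succ_of_le h1) h2 k hk

lemma cucbsc_cost_eq_zero (hγ : 0 < γ) (m : CacheModel F) {j t : ℕ}
    (h1 : switchTime F γ j < t) (h2 : t < switchTime F γ (j + 1)) :
    m.cost (cucbsc (switchTime F γ) init solve x u t).cache
      (cucbsc (switchTime F γ) init solve x u (t - 1)).cache = 0 := by
  rw [cucbsc_cache_block init solve x u hγ h1.le h2,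
    cucbsc_cache_block init solve x u hγ (t := t - 1) (j := j) (by omega) (by omega), m.cost_self]

lemma cucbsc_plays_block (hγ : 0 < γ) {j t : ℕ} (h1 : switchTime F γ j - 1 ≤ t)
    (h2 : t < switchTime F γ (j + 1)) (f : Fin F) :
    (cucbsc (switchTime F γ) init solve x u t).plays f
      = (cucbsc (switchTime F γ) init solve x u (switchTime F γ j - 1)).plays f
        + if f ∈ (cucbsc (switchTime F γ) init solve x u (switchTime F γ j)).cache then
            t - (switchTime F γ j - 1) else 0 := by
  induction t, h1 using Nat.le_induction with
  | base => simp
  | succ t h1 ih =>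
    rw [cucbsc_plays_succ, ih (by omega),
      cucbsc_cache_block init solve x u hγ (by omega) h2]
    split_ifs <;> omega

/-- Counters are read just before a switch, as the solver sees them. A chosen file stays cached for
the whole block, which is the growth required by the charging argument. -/
lemma cucbsc_plays_switchTime_succ (hγ : 0 < γ) (j : ℕ) (f : Fin F) :
    (cucbsc (switchTime F γ) init solve x u (switchTime F γ (j + 1) - 1)).plays f
      = (cucbsc (switchTime F γ) init solve x u (switchTime F γ j - 1)).plays f
        + if f ∈ (cucbsc (switchTime F γ) init solve x u (switchTime F γ j)).cache then
            blockLen γ (switchTime F γ j) else 0 := by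
  have := switchTime_strictMono F hγ (Nat.lt_add_one j)
  have h0 := le_switchTime F γ j
  rw [cucbsc_plays_block init solve x u hγ (t := switchTime F γ (j + 1) - 1) (j := j)
    (by omega) (by omega)]
  congr 2
  simp only [switchTime]
  omega

end Run

/-! ### Charging bad blocks to rarely observed files. -/

section Counting

/-- If a counter `τ` grows by at least `a j` at the indices `j` with `p j`, and is at most `ℓ` at
these indices, then the sum of `a` over them is at most `ℓ - c` up to one summand. -/
lemma sum_le_of_counter {a τ : ℕ → ℝ} (hmono : Monotone τ) {ℓ c D : ℝ} {p : ℕ → Prop}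
    [DecidablePred p] (hstep : ∀ j, p j → τ j + a j ≤ τ (j + 1)) (hle : ∀ j, p j → τ j ≤ ℓ) (J : ℕ)
    (hD : ∀ j < J, a j ≤ D) (hc : c ≤ τ 0) (hc' : c ≤ ℓ + D) :
    ∑ j ∈ Finset.range J, (if p j then a j else 0) ≤ ℓ + D - c := by
  -- The bound by the current counter has to be carried along: at a charged index it is at most `ℓ -
  -- c` before the charge, and the charge adds at most `D`.
  suffices h : ∑ j ∈ Finset.range J, (if p j then a j else 0) ≤ τ J - c ∧
      ∑ j ∈ Finset.range J, (if p j then a j else 0) ≤ ℓ + D - c from h.2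
  induction J with
  | zero => simpa using ⟨hc, hc'⟩
  | succ J ih =>
    obtain ⟨h1, h2⟩ := ih fun j hj => hD j (by omega)
    rw [Finset.sum_range_succ]
    split_ifs with hp
    · have := hstep J hp
      have := hle J hp
      have := hD J (by omega)
      constructor <;> linarith
    · have := hmono (Nat.le_succ J)
      constructor <;> linarith

open Classical in
/-- The counting argument for several counters: each index `j` in `q` is charged to a counter
`τ f` that is at most `ℓ` and that grows by at least `a j`. -/
lemma sum_le_of_counters {ι : Type*} [Fintype ι] {a : ℕ → ℝ} {τ : ℕ → ι → ℝ}
    (ha : ∀ j, 0 ≤ a j) (hmono : ∀ f, Monotone fun j => τ j f) {ℓ c D : ℝ} {q : ℕ → ι → Prop}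
    (hstep : ∀ j f, q j f → τ j f + a j ≤ τ (j + 1) f) (J : ℕ)
    (hD : ∀ j < J, a j ≤ D) (hc : ∀ f, c ≤ τ 0 f) (hc' : c ≤ ℓ + D) :
    ∑ j ∈ Finset.range J, (if ∃ f, q j f ∧ τ j f ≤ ℓ then a j else 0)
      ≤ Fintype.card ι * (ℓ + D - c) := by
  calc ∑ j ∈ Finset.range J, (if ∃ f, q j f ∧ τ j f ≤ ℓ then a j else 0)
      ≤ ∑ j ∈ Finset.range J, ∑ f : ι, (if q j f ∧ τ j f ≤ ℓ then a j else 0) := by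
        refine Finset.sum_le_sum fun j _ => ?_
        have hnn : ∀ f ∈ Finset.univ, 0 ≤ if q j f ∧ τ j f ≤ ℓ then a j else 0 := fun f _ => by
          split_ifs
          · exact ha j
          · exact le_rfl
        split_ifs with h
        · obtain ⟨f, hf⟩ := h
          refine le_trans ?_ (Finset.single_le_sum hnn (Finset.mem_univ f))
          rw [if_pos hf]
        · exact Finset.sum_nonneg hnn
    _ = ∑ f : ι, ∑ j ∈ Finset.range J, (if q j f ∧ τ j f ≤ ℓ then a j else 0) :=
        Finset.sum_comm
    _ ≤ ∑ _f : ι, (ℓ + D - c) := Finset.sum_le_sum fun f _ =>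
        sum_le_of_counter (p := fun j => q j f ∧ τ j f ≤ ℓ) (hmono f) (fun j h => hstep j f h.1) (fun j h => h.2) J hD (hc f) hc'
    _ = Fintype.card ι * (ℓ + D - c) := by rw [Finset.sum_const, Finset.card_univ, nsmul_eq_mul]

end Counting

/-! ### Hoeffding bounds under optional skipping. -/

section Concentration

variable {Ω : Type*} [mΩ : MeasurableSpace Ω] {P : Measure Ω} [IsProbabilityMeasure P]

/-- Hoeffding's lemma, in the form needed for exponential supermartingales. -/
lemma lintegral_exp_hoeffding_le_one {X : Ω → ℝ} (hX : Measurable X)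
    (hmem : ∀ᵐ ω ∂P, X ω ∈ Set.Icc (0 : ℝ) 1) (c : ℝ) :
    ∫⁻ ω, ENNReal.ofReal (Real.exp (c * (X ω - ∫ ω', X ω' ∂P) - c ^ 2 / 8)) ∂P ≤ 1 := by
  have h := hasSubgaussianMGF_of_mem_Icc hX.aemeasurable hmem
  have hint : Integrable (fun ω => Real.exp (c * (X ω - ∫ ω', X ω' ∂P) - c ^ 2 / 8)) P := by
    simp_rw [sub_eq_add_neg _ (c ^ 2 / 8), Real.exp_add]
    exact (h.integrable_exp_mul c).mul_const _
  rw [← ofReal_integral_eq_lintegral_ofReal hint (ae_of_all _ fun ω => (Real.exp_pos _).le)]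
  refine ENNReal.ofReal_le_one.2 ?_
  simp_rw [sub_eq_add_neg _ (c ^ 2 / 8), Real.exp_add]
  rw [integral_mul_const]
  have hm := h.mgf_le c
  simp only [mgf] at hm
  refine (mul_le_mul_of_nonneg_right hm (Real.exp_pos _).le).trans ?_
  rw [← Real.exp_add]
  refine Real.exp_le_one_iff.2 (le_of_eq ?_)
  simp
  ring

variable {𝓗 : ℕ → MeasurableSpace Ω} {X : ℕ → Ω → ℝ} {e : ℕ → Set Ω} {μ₀ : ℝ}

/-- Exponential supermartingale for optional skipping: the sample `X i` is used if `e i` happens,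
and `e i` is determined before `X i` is drawn. -/
lemma lintegral_exp_skipping_le_one (h𝓗 : ∀ t, 𝓗 t ≤ mΩ)
    (he : ∀ t, ∀ i ≤ t, MeasurableSet[𝓗 t] (e i))
    (hX : ∀ t, ∀ i < t, Measurable[𝓗 t] (X i)) (hXm : ∀ t, Measurable (X t))
    (hind : ∀ t, Indep (𝓗 t) (MeasurableSpace.comap (X t) inferInstance) P)
    (hmem : ∀ t, ∀ᵐ ω ∂P, X t ω ∈ Set.Icc (0 : ℝ) 1) (hmean : ∀ t, ∫ ω, X t ω ∂P = μ₀)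
    (c : ℝ) (t : ℕ) :
    ∫⁻ ω, ENNReal.ofReal (Real.exp
      (c * ∑ i ∈ Finset.range t, (e i).indicator (fun ω => X i ω - μ₀) ω
        - c ^ 2 / 8 * ∑ i ∈ Finset.range t, (e i).indicator (fun _ => (1 : ℝ)) ω)) ∂P ≤ 1 := by
  induction t with
  | zero => simp
  | succ t ih =>
    set W : Ω → ENNReal := fun ω => ENNReal.ofReal (Real.exp
      (c * ∑ i ∈ Finset.range t, (e i).indicator (fun ω => X i ω - μ₀) ω
        - c ^ 2 / 8 * ∑ i ∈ Finset.range t, (e i).indicator (fun _ => (1 : ℝ)) ω)) with hW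
    set G : Ω → ENNReal := fun ω =>
      ENNReal.ofReal (Real.exp (c * (X t ω - μ₀) - c ^ 2 / 8)) with hG
    have hWm : Measurable[𝓗 t] W := by
      refine ENNReal.measurable_ofReal.comp (Real.measurable_exp.comp (Measurable.sub ?_ ?_))
      · refine Measurable.const_mul (Finset.measurable_sum _ fun i hi => ?_) c
        rw [Finset.mem_range] at hi
        exact ((hX t i hi).sub_const μ₀).indicator (he t i hi.le)
      · refine Measurable.const_mul (Finset.measurable_sum _ fun i hi => ?_) _
        rw [Finset.mem_range] at hi
        exact measurable_const.indicator (he t i hi.le)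
    have hGm : Measurable[MeasurableSpace.comap (X t) inferInstance] G := by
      have : Measurable fun x : ℝ => ENNReal.ofReal (Real.exp (c * (x - μ₀) - c ^ 2 / 8)) := by
        fun_prop
      exact this.comp (comap_measurable (X t))
    have hWe : Measurable[𝓗 t] ((e t).indicator W) := hWm.indicator (he t t le_rfl)
    have hG1 : ∫⁻ ω, G ω ∂P ≤ 1 := by
      have := lintegral_exp_hoeffding_le_one (hXm t) (hmem t) c
      rwa [hmean t] at this
    -- A skipped sample leaves the weight unchanged; a used one multiplies it by `G`, which is
    -- independent of the past and has mean at most one.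
    have hsplit : ∀ ω, ENNReal.ofReal (Real.exp
        (c * ∑ i ∈ Finset.range (t + 1), (e i).indicator (fun ω => X i ω - μ₀) ω
        - c ^ 2 / 8 * ∑ i ∈ Finset.range (t + 1), (e i).indicator (fun _ => (1 : ℝ)) ω))
        = (e t)ᶜ.indicator W ω + (e t).indicator W ω * G ω := by
      intro ω
      rw [Finset.sum_range_succ, Finset.sum_range_succ]
      by_cases hω : ω ∈ e t
      · have hω' : ω ∉ (e t)ᶜ := fun h => h hω
        simp only [Set.indicator_of_mem hω, Set.indicator_of_notMem hω', hW, hG, zero_add]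
        rw [← ENNReal.ofReal_mul (Real.exp_pos _).le, ← Real.exp_add]
        congr 2
        ring
      · have hω' : ω ∈ (e t)ᶜ := hω
        simp [Set.indicator_of_mem hω', Set.indicator_of_notMem hω, hW]
    simp_rw [hsplit]
    have hWe' : Measurable ((e t).indicator W) := hWe.mono (h𝓗 t) le_rfl
    have hWc : Measurable ((e t)ᶜ.indicator W) :=
      (hWm.indicator (he t t le_rfl).compl).mono (h𝓗 t) le_rfl
    rw [lintegral_add_left hWc,
      lintegral_mul_eq_lintegral_mul_lintegral_of_independent_measurableSpace (h𝓗 t)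
        (hXm t).comap_le (hind t) hWe hGm]
    calc _ ≤ ∫⁻ ω, (e t)ᶜ.indicator W ω ∂P + ∫⁻ ω, (e t).indicator W ω ∂P := by
          gcongr
          exact mul_le_of_le_one_right' hG1
      _ = ∫⁻ ω, W ω ∂P := by
          rw [← lintegral_add_left hWc]
          congr 1
          ext ω
          by_cases hω : ω ∈ e t <;> simp [hω]
      _ ≤ 1 := ih

/-- Hoeffding's inequality for the sum of those samples that are used, on the event that their
number is `s`. -/
lemma measureReal_skipping_tail_le (h𝓗 : ∀ t, 𝓗 t ≤ mΩ)
    (he : ∀ t, ∀ i ≤ t, MeasurableSet[𝓗 t] (e i))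
    (hX : ∀ t, ∀ i < t, Measurable[𝓗 t] (X i)) (hXm : ∀ t, Measurable (X t))
    (hind : ∀ t, Indep (𝓗 t) (MeasurableSpace.comap (X t) inferInstance) P)
    (hmem : ∀ t, ∀ᵐ ω ∂P, X t ω ∈ Set.Icc (0 : ℝ) 1) (hmean : ∀ t, ∫ ω, X t ω ∂P = μ₀)
    (t : ℕ) (s ε σ : ℝ) (hσ : σ ^ 2 = 1) (hε : 0 ≤ ε) :
    P.real {ω | ∑ i ∈ Finset.range t, (e i).indicator (fun _ => (1 : ℝ)) ω = s ∧
      s * ε ≤ σ * ∑ i ∈ Finset.range t, (e i).indicator (fun ω => X i ω - μ₀) ω}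
      ≤ Real.exp (-(2 * (s * ε ^ 2))) := by
  -- The parameter `4ε` maximizes `cεs - c²s/8`, with value `2sε²`; the sign `σ` selects the upper
  -- or the lower tail. Markov's inequality follows.
  have h1 := lintegral_exp_skipping_le_one h𝓗 he hX hXm hind hmem hmean (4 * ε * σ) t
  have hmeas : AEMeasurable (fun ω => ENNReal.ofReal (Real.exp
      (4 * ε * σ * ∑ i ∈ Finset.range t, (e i).indicator (fun ω => X i ω - μ₀) ω
        - (4 * ε * σ) ^ 2 / 8 *
          ∑ i ∈ Finset.range t, (e i).indicator (fun _ => (1 : ℝ)) ω))) P := by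
    have hei : ∀ i, MeasurableSet (e i) := fun i => h𝓗 i _ (he i i le_rfl)
    refine (ENNReal.measurable_ofReal.comp (Real.measurable_exp.comp
      (Measurable.sub ?_ ?_))).aemeasurable
    · exact Measurable.const_mul (Finset.measurable_sum _ fun i _ =>
        ((hXm i).sub_const μ₀).indicator (hei i)) _
    · exact Measurable.const_mul (Finset.measurable_sum _ fun i _ =>
        measurable_const.indicator (hei i)) _
  have h2 := (mul_meas_ge_le_lintegral₀ hmeas
    (ENNReal.ofReal (Real.exp (2 * (s * ε ^ 2))))).trans h1
  have hsub : {ω | ∑ i ∈ Finset.range t, (e i).indicator (fun _ => (1 : ℝ)) ω = s ∧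
      s * ε ≤ σ * ∑ i ∈ Finset.range t, (e i).indicator (fun ω => X i ω - μ₀) ω} ⊆
      {ω | ENNReal.ofReal (Real.exp (2 * (s * ε ^ 2))) ≤ ENNReal.ofReal (Real.exp
        (4 * ε * σ * ∑ i ∈ Finset.range t, (e i).indicator (fun ω => X i ω - μ₀) ω
        - (4 * ε * σ) ^ 2 / 8 *
          ∑ i ∈ Finset.range t, (e i).indicator (fun _ => (1 : ℝ)) ω))} := by
    rintro ω ⟨ha, hb⟩
    refine ENNReal.ofReal_le_ofReal (Real.exp_le_exp.2 ?_)
    rw [ha]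
    have hc := mul_le_mul_of_nonneg_left hb (by positivity : 0 ≤ 4 * ε)
    have : (4 * ε * σ) ^ 2 / 8 * s = 2 * (s * ε ^ 2) := by
      rw [mul_pow, hσ]
      ring
    rw [this]
    linarith
  have h3 := (mul_le_mul_right (measure_mono (μ := P) hsub) _).trans h2
  have h4 := ENNReal.toReal_mono (by simp) h3
  rw [ENNReal.toReal_mul, ENNReal.toReal_ofReal (Real.exp_pos _).le, ENNReal.toReal_one] at h4
  rw [Real.exp_neg, ← one_div, le_div_iff₀ (Real.exp_pos _), mul_comm]
  exact h4

/-- Uniform deviation bound for the mean of the samples that are used among the first `t`. -/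
lemma measureReal_skipping_deviation_le (h𝓗 : ∀ t, 𝓗 t ≤ mΩ)
    (he : ∀ t, ∀ i ≤ t, MeasurableSet[𝓗 t] (e i))
    (hX : ∀ t, ∀ i < t, Measurable[𝓗 t] (X i)) (hXm : ∀ t, Measurable (X t))
    (hind : ∀ t, Indep (𝓗 t) (MeasurableSpace.comap (X t) inferInstance) P)
    (hmem : ∀ t, ∀ᵐ ω ∂P, X t ω ∈ Set.Icc (0 : ℝ) 1) (hmean : ∀ t, ∫ ω, X t ω ∂P = μ₀)
    (t : ℕ) :
    P.real {ω | ∃ s : ℕ, 1 ≤ s ∧ s ≤ t ∧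
      ∑ i ∈ Finset.range t, (e i).indicator (fun _ => (1 : ℝ)) ω = s ∧
      s * √(3 * Real.log (t + 1 : ℕ) / (2 * s))
        ≤ |∑ i ∈ Finset.range t, (e i).indicator (fun ω => X i ω - μ₀) ω|}
      ≤ 2 / ((t + 1 : ℕ) : ℝ) ^ 2 := by
  set L := Real.log (t + 1 : ℕ) with hL
  have hL0 : 0 ≤ L := Real.log_natCast_nonneg _
  set E : ℝ → ℕ → Set Ω := fun σ s =>
    {ω | ∑ i ∈ Finset.range t, (e i).indicator (fun _ => (1 : ℝ)) ω = (s : ℝ) ∧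
      s * √(3 * L / (2 * s))
        ≤ σ * ∑ i ∈ Finset.range t, (e i).indicator (fun ω => X i ω - μ₀) ω} with hE
  have hEle : ∀ σ : ℝ, σ ^ 2 = 1 → ∀ s ∈ Finset.Icc 1 t,
      P.real (E σ s) ≤ 1 / ((t + 1 : ℕ) : ℝ) ^ 3 := by
    intro σ hσ s hs
    rw [Finset.mem_Icc] at hs
    have hs0 : (0 : ℝ) < s := by exact_mod_cast hs.1
    refine (measureReal_skipping_tail_le h𝓗 he hX hXm hind hmem hmean t s _ σ hσ
      (Real.sqrt_nonneg _)).trans (le_of_eq ?_)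
    rw [Real.sq_sqrt (by positivity)]
    -- For every `s` the radius yields the same probability `(t+1)⁻³`; the union over the at most
    -- `t` values of `s` costs one power.
    have : -(2 * ((s : ℝ) * (3 * L / (2 * s)))) = -((3 : ℕ) * L) := by
      field_simp
      push_cast
      ring
    rw [this, Real.exp_neg, Real.exp_nat_mul, hL, Real.exp_log (by positivity), one_div]
  have hsub : {ω | ∃ s : ℕ, 1 ≤ s ∧ s ≤ t ∧
      ∑ i ∈ Finset.range t, (e i).indicator (fun _ => (1 : ℝ)) ω = s ∧
      s * √(3 * L / (2 * s))
        ≤ |∑ i ∈ Finset.range t, (e i).indicator (fun ω => X i ω - μ₀) ω|} ⊆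
      (⋃ s ∈ Finset.Icc 1 t, E 1 s) ∪ ⋃ s ∈ Finset.Icc 1 t, E (-1) s := by
    rintro ω ⟨s, hs1, hst, ha, hb⟩
    have hs : s ∈ Finset.Icc 1 t := Finset.mem_Icc.2 ⟨hs1, hst⟩
    rcases le_abs.1 hb with hb | hb
    · exact Or.inl (Set.mem_biUnion hs ⟨ha, by simpa using hb⟩)
    · exact Or.inr (Set.mem_biUnion hs ⟨ha, by simpa using hb⟩)
  have hU : ∀ σ : ℝ, σ ^ 2 = 1 →
      P.real (⋃ s ∈ Finset.Icc 1 t, E σ s) ≤ 1 / ((t + 1 : ℕ) : ℝ) ^ 2 := by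
    intro σ hσ
    refine (measureReal_biUnion_finset_le _ _).trans
      ((Finset.sum_le_card_nsmul _ _ _ (hEle σ hσ)).trans ?_)
    rw [Nat.card_Icc, nsmul_eq_mul, Nat.add_sub_cancel]
    have h0 : (0 : ℝ) < ((t + 1 : ℕ) : ℝ) := by positivity
    rw [mul_one_div, div_le_div_iff₀ (by positivity) (by positivity)]
    have h1 : (t : ℝ) ≤ ((t + 1 : ℕ) : ℝ) := by exact_mod_cast Nat.le_succ t
    calc (t : ℝ) * ((t + 1 : ℕ) : ℝ) ^ 2 ≤ ((t + 1 : ℕ) : ℝ) * ((t + 1 : ℕ) : ℝ) ^ 2 := by gcongr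
      _ = 1 * ((t + 1 : ℕ) : ℝ) ^ 3 := by ring
  calc _ ≤ P.real ((⋃ s ∈ Finset.Icc 1 t, E 1 s) ∪ ⋃ s ∈ Finset.Icc 1 t, E (-1) s) :=
        measureReal_mono hsub
    _ ≤ _ := measureReal_union_le _ _
    _ ≤ _ := add_le_add (hU 1 (by norm_num)) (hU (-1) (by norm_num))
    _ = _ := by ring

end Concentration

/-! ### Independence of the present from the history. -/

section Independence

variable {Ω : Type*} [mΩ : MeasurableSpace Ω] {P : Measure Ω} [IsProbabilityMeasure P]

/-- Both hypotheses say that the joint law of the three variables is a product; the conclusion is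
the same product, bracketed differently. -/
lemma ProbabilityTheory.IndepFun.prodMk_right_of_indepFun_prodMk {A B C : Type*}
    [MeasurableSpace A] [MeasurableSpace B] [MeasurableSpace C] {X : Ω → A} {Y : Ω → B} {Z : Ω → C}
    (hX : Measurable X) (hY : Measurable Y) (hZ : Measurable Z)
    (h1 : IndepFun X Y P) (h2 : IndepFun (fun ω => (X ω, Y ω)) Z P) :
    IndepFun X (fun ω => (Y ω, Z ω)) P := by
  have hYZ : IndepFun Y Z P := h2.comp measurable_snd measurable_id
  have := Measure.isProbabilityMeasure_map (μ := P) hX.aemeasurable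
  have := Measure.isProbabilityMeasure_map (μ := P) hY.aemeasurable
  have := Measure.isProbabilityMeasure_map (μ := P) hZ.aemeasurable
  rw [indepFun_iff_map_prod_eq_prod_map_map hX.aemeasurable (hY.prodMk hZ).aemeasurable]
  rw [indepFun_iff_map_prod_eq_prod_map_map hX.aemeasurable hY.aemeasurable] at h1
  rw [indepFun_iff_map_prod_eq_prod_map_map (hX.prodMk hY).aemeasurable hZ.aemeasurable] at h2
  rw [indepFun_iff_map_prod_eq_prod_map_map hY.aemeasurable hZ.aemeasurable] at hYZ
  rw [hYZ, ← Measure.prodAssoc_prod, ← h1, ← h2,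
    Measure.map_map (MeasurableEquiv.measurable _) ((hX.prodMk hY).prodMk hZ)]
  rfl

/-- If the `X i` are independent, and jointly independent of `Z`, then `X (t + 1)` is independent
of the σ-algebra generated by `X 0, …, X t` and `Z`. -/
lemma ProbabilityTheory.iIndepFun.indep_history {A C : Type*} [MeasurableSpace A]
    [MeasurableSpace C] {X : ℕ → Ω → A} {Z : Ω → C} (hX : ∀ t, Measurable (X t))
    (hZ : Measurable Z) (h1 : iIndepFun X P) (h2 : IndepFun (fun ω t => X t ω) Z P) (t : ℕ) :
    Indep (MeasurableSpace.comap
        (fun ω => ((fun i : Finset.range (t + 1) => X i ω), Z ω)) inferInstance)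
      (MeasurableSpace.comap (X (t + 1)) inferInstance) P := by
  have hY : Measurable fun ω (i : Finset.range (t + 1)) => X i ω :=
    measurable_pi_lambda _ fun i => hX i
  have h3 := h1.indepFun_finset {t + 1} (Finset.range (t + 1)) (by simp) hX
  have h4 : IndepFun (X (t + 1)) (fun ω (i : Finset.range (t + 1)) => X i ω) P :=
    h3.comp (measurable_pi_apply (⟨t + 1, by simp⟩ : ({t + 1} : Finset ℕ))) measurable_id
  have h5 : IndepFun (fun ω => (X (t + 1) ω, fun i : Finset.range (t + 1) => X i ω)) Z P := by
    refine h2.comp (φ := fun x : ℕ → A => (x (t + 1), fun i : Finset.range (t + 1) => x i)) ?_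
      measurable_id
    exact (measurable_pi_apply _).prodMk (measurable_pi_lambda _ fun i => measurable_pi_apply _)
  exact (h4.prodMk_right_of_indepFun_prodMk (hX _) hY hZ h5).symm

end Independence

/-! ### Measurability of the run and of the solver's success. -/

section Measurability

variable {Ω : Type*} [MeasurableSpace Ω]

/-- Contents range over a finite type without a chosen σ-algebra. Measurable fibers make every
property of the content an event. -/
lemma measurableSet_of_forall_fiber {ι : Type*} [Finite ι] {c : Ω → ι}
    (hc : ∀ a, MeasurableSet {ω | c ω = a}) (q : ι → Prop) : MeasurableSet {ω | q (c ω)} := by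
  let : MeasurableSpace ι := ⊤
  have : Measurable c := measurable_to_countable' hc
  exact this (MeasurableSpace.measurableSet_top (s := {a | q a}))

lemma measurable_comp_of_forall_fiber {ι β : Type*} [Finite ι] [MeasurableSpace β] {c : Ω → ι}
    (hc : ∀ a, MeasurableSet {ω | c ω = a}) (h : ι → β) : Measurable fun ω => h (c ω) := fun s _ =>
  measurableSet_of_forall_fiber hc fun a => h a ∈ s

variable {F : ℕ} {Seed : Type*} [MeasurableSpace Seed] {n : ℕ → ℕ} {init : ℕ → Finset (Fin F)}
  {solve : (Fin F → ℝ) → Seed → Finset (Fin F)} {x : ℕ → Ω → Fin F → ℝ} {u : ℕ → Ω → Seed}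

variable (n init solve x u) in
/-- The state of the run of CUCBSC after period `t`, as a random variable. -/
noncomputable def cucbRun (t : ℕ) (ω : Ω) : CucbState F :=
  cucbsc n init solve (fun i => x i ω) (fun i => u i ω) t

/-- Measurability of a random state, component by component. -/
structure CucbState.IsMeasurable (s : Ω → CucbState F) : Prop where
  cache : ∀ A, MeasurableSet {ω | (s ω).cache = A}
  plays : ∀ f, Measurable fun ω => (s ω).plays f
  mean : ∀ f, Measurable fun ω => (s ω).mean f

lemma CucbState.IsMeasurable.perturbed {s : Ω → CucbState F} (hs : CucbState.IsMeasurable s)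
    (t : ℕ) : Measurable fun ω => (s ω).perturbed t := by
  refine measurable_pi_lambda _ fun f => (hs.mean f).add ?_
  exact (measurable_from_top (f := fun k : ℕ => √(3 * Real.log t / (2 * (k : ℝ))))).comp
    (hs.plays f)

lemma cucbRun_cache_succ_measurable (hsolve : ∀ A, MeasurableSet
    {p : (Fin F → ℝ) × Seed | solve p.1 p.2 = A}) {t : ℕ}
    (hs : CucbState.IsMeasurable (cucbRun n init solve x u t)) (hu : Measurable (u (t + 1)))
    (A : Finset (Fin F)) :
    MeasurableSet {ω | (cucbRun n init solve x u (t + 1) ω).cache = A} := by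
  simp only [cucbRun, cucbsc_cache_succ]
  split_ifs with h1 h2
  · exact MeasurableSet.const _
  · exact ((hs.perturbed (t + 1)).prodMk hu) (hsolve A)
  · exact hs.cache A

lemma cucbRun_isMeasurable (hsolve : ∀ A, MeasurableSet
    {p : (Fin F → ℝ) × Seed | solve p.1 p.2 = A}) {t : ℕ} (hx : ∀ i ≤ t, Measurable (x i))
    (hu : ∀ i ≤ t, Measurable (u i)) :
    CucbState.IsMeasurable (cucbRun n init solve x u t) := by
  induction t with
  | zero =>
    constructor <;> intros <;> simp only [cucbRun, cucbsc]
    · exact MeasurableSet.const _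
    · exact measurable_const
    · exact measurable_const
  | succ t ih =>
    have ih := ih (fun i hi => hx i (by omega)) fun i hi => hu i (by omega)
    have hc := cucbRun_cache_succ_measurable hsolve ih (hu (t + 1) le_rfl)
    have hf : ∀ f, MeasurableSet {ω | f ∈ (cucbRun n init solve x u (t + 1) ω).cache} :=
      fun f => measurableSet_of_forall_fiber hc fun A => f ∈ A
    refine ⟨hc, fun f => ?_, fun f => ?_⟩
    · simp only [cucbRun, cucbsc_plays_succ]
      exact (ih.plays f).add (Measurable.ite (hf f) measurable_const measurable_const)
    · simp only [cucbRun, cucbsc_mean_succ]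
      have hp : Measurable fun ω => ((cucbRun n init solve x u t ω).plays f : ℝ) :=
        measurable_from_top.comp (ih.plays f)
      exact Measurable.ite (hf f) ((((ih.mean f).mul hp).add
        ((measurable_pi_apply f).comp (hx (t + 1) le_rfl))).div (hp.add_const 1)) (ih.mean f)

lemma CacheModel.measurable_reward (m : CacheModel F) (A : Finset (Fin F)) :
    Measurable fun v => m.reward v A := by
  unfold CacheModel.reward
  fun_prop

lemma CacheModel.measurableSet_solver_success (m : CacheModel F) (hemp : m.Feasible ∅)
    (hsolve : ∀ A, MeasurableSet {p : (Fin F → ℝ) × Seed | solve p.1 p.2 = A}) {α : ℝ}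
    (hα : 0 ≤ α) :
    MeasurableSet {p : (Fin F → ℝ) × Seed | α * m.opt p.1 ≤ m.reward p.1 (solve p.1 p.2)} := by
  have : {p : (Fin F → ℝ) × Seed | α * m.opt p.1 ≤ m.reward p.1 (solve p.1 p.2)} =
      ⋃ A : Finset (Fin F), {p | solve p.1 p.2 = A} ∩
        ⋂ B : {B // m.Feasible B}, {p | α * m.reward p.1 B ≤ m.reward p.1 A} := by
    ext p
    simp [m.mul_opt_le_iff hemp hα]
  rw [this]
  refine MeasurableSet.iUnion fun A => (hsolve A).inter (MeasurableSet.iInter fun B => ?_)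
  exact measurableSet_le (((m.measurable_reward B).comp measurable_fst).const_mul α)
    ((m.measurable_reward A).comp measurable_fst)

end Measurability

/-! ### Solver success and confidence bounds along the run. -/

section Environment

variable {F : ℕ} {m : CacheModel F} {Ω Seed : Type*} [mΩ : MeasurableSpace Ω]
  [MeasurableSpace Seed] {P : Measure Ω} {ν : Measure Seed} {θ : Fin F → ℝ} {d : ℕ → Ω → Fin F → ℝ} {ξ : ℕ → Ω → Seed}
  {α β : ℝ} {solve : (Fin F → ℝ) → Seed → Finset (Fin F)} {init : ℕ → Finset (Fin F)}
  {n : ℕ → ℕ}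

lemma IsEnvironment.ae_nonneg (henv : IsEnvironment P ν θ d ξ) :
    ∀ᵐ ω ∂P, ∀ t, 0 ≤ d t ω := by
  refine ae_all_iff.2 fun t => ?_
  filter_upwards [ae_all_iff.2 (henv.demand_mem t)] with ω h f using (h f).1

lemma IsEnvironment.mean_nonneg (henv : IsEnvironment P ν θ d ξ) : 0 ≤ θ := fun f => by
  rw [← henv.demand_mean 0 f]
  refine integral_nonneg_of_ae ?_
  filter_upwards [henv.demand_mem 0 f] with ω h using h.1

lemma IsEnvironment.cucbRun_isMeasurable (henv : IsEnvironment P ν θ d ξ)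
    (hsolve : m.IsSolver α β ν solve) (t : ℕ) :
    CucbState.IsMeasurable (cucbRun n init solve d ξ t) :=
  _root_.cucbRun_isMeasurable hsolve.measurable (fun i _ => henv.measurable_demand i)
    fun i _ => henv.measurable_seed i

variable [IsProbabilityMeasure P]

/-- In a switching period the solver succeeds with probability at least `β`. -/
lemma IsEnvironment.le_measureReal_solver_success [IsProbabilityMeasure ν]
    (henv : IsEnvironment P ν θ d ξ)
    (hsolve : m.IsSolver α β ν solve) (hemp : m.Feasible ∅) (hα : 0 ≤ α) {t : ℕ}
    (hF : F < t + 1) (hn : ∃ j, n j = t + 1) :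
    β ≤ P.real {ω | α * m.opt ((cucbRun n init solve d ξ t ω).perturbed (t + 1)) ≤
      m.reward ((cucbRun n init solve d ξ t ω).perturbed (t + 1))
        (cucbRun n init solve d ξ (t + 1) ω).cache} := by
  set v : Ω → Fin F → ℝ := fun ω => (cucbRun n init solve d ξ t ω).perturbed (t + 1) with hv
  have hcache : ∀ ω, (cucbRun n init solve d ξ (t + 1) ω).cache = solve (v ω) (ξ (t + 1) ω) := by
    intro ω
    simp only [cucbRun, cucbsc_cache_succ, hv]
    rw [if_neg (by omega), if_pos hn]
  simp_rw [hcache]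
  have hvm : Measurable v := (henv.cucbRun_isMeasurable hsolve t).perturbed _
  have hdm : Measurable fun ω t => d t ω := measurable_pi_lambda _ henv.measurable_demand
  have hhist := henv.seed_indep.indep_history henv.measurable_seed hdm henv.indep.symm t
  -- The history contains all demands, even future ones, but only past seeds. It determines the
  -- profile handed to the solver and is independent of the fresh seed.
  set H := fun ω => ((fun i : Finset.range (t + 1) => ξ i ω), fun t => d t ω) with hH
  have hHm : Measurable[MeasurableSpace.comap H inferInstance] H := comap_measurable H
  have hvH : Measurable[MeasurableSpace.comap H inferInstance] v := by
    refine @CucbState.IsMeasurable.perturbed Ω (MeasurableSpace.comap H inferInstance) F _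
      (@_root_.cucbRun_isMeasurable Ω (MeasurableSpace.comap H inferInstance) F Seed _ n init
        solve d ξ hsolve.measurable t (fun i _ => ?_) fun i hi => ?_) _
    · exact (measurable_pi_apply i).comp (measurable_snd.comp hHm)
    · exact (measurable_pi_apply (⟨i, Finset.mem_range.2 (by omega)⟩ : Finset.range (t + 1))).comp
        (measurable_fst.comp hHm)
  have hind : IndepFun v (ξ (t + 1)) P :=
    indep_of_indep_of_le_left hhist (measurable_iff_comap_le.1 hvH)
  have hS := m.measurableSet_solver_success hemp hsolve.measurable hα
  have hmap := (indepFun_iff_map_prod_eq_prod_map_map hvm.aemeasurable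
    (henv.measurable_seed (t + 1)).aemeasurable).1 hind
  rw [henv.seed_law] at hmap
  have := Measure.isProbabilityMeasure_map (μ := P) hvm.aemeasurable
  -- The solver's guarantee covers nonnegative profiles only, and demands are nonnegative only
  -- almost surely.
  have hae : ∀ᵐ y ∂P.map v, 0 ≤ y := by
    rw [ae_map_iff hvm.aemeasurable measurableSet_Ici]
    filter_upwards [henv.ae_nonneg] with ω hω
    exact cucbsc_perturbed_nonneg n init solve _ _ hω t (t + 1)
  have key : ENNReal.ofReal β ≤ P {ω | α * m.opt (v ω) ≤
      m.reward (v ω) (solve (v ω) (ξ (t + 1) ω))} := by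
    calc ENNReal.ofReal β = ∫⁻ _y, ENNReal.ofReal β ∂P.map v := by simp
      _ ≤ ∫⁻ y, ν (Prod.mk y ⁻¹' {p : (Fin F → ℝ) × Seed |
            α * m.opt p.1 ≤ m.reward p.1 (solve p.1 p.2)}) ∂P.map v :=
          lintegral_mono_ae (hae.mono fun y hy => hsolve.success y hy)
      _ = P.map (fun ω => (v ω, ξ (t + 1) ω)) {p : (Fin F → ℝ) × Seed |
            α * m.opt p.1 ≤ m.reward p.1 (solve p.1 p.2)} := by
          rw [hmap, Measure.prod_apply hS]
      _ = _ := by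
          rw [Measure.map_apply (hvm.prodMk (henv.measurable_seed _)) hS]
          rfl
  exact (ENNReal.ofReal_le_iff_le_toReal (measure_ne_top _ _)).1 key

/-- Concentration of the sample mean of a single file. -/
lemma IsEnvironment.measureReal_mean_deviation_le (henv : IsEnvironment P ν θ d ξ)
    (hsolve : m.IsSolver α β ν solve) (hinit : m.IsInit init) {t : ℕ} (ht : F ≤ t) (f : Fin F) :
    P.real {ω | √(3 * Real.log (t + 1 : ℕ) / (2 * (cucbRun n init solve d ξ t ω).plays f)) ≤
      |(cucbRun n init solve d ξ t ω).mean f - θ f|} ≤ 2 / ((t + 1 : ℕ) : ℝ) ^ 2 := by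
  have hξm : Measurable fun ω t => ξ t ω := measurable_pi_lambda _ henv.measurable_seed
  -- The roles are exchanged here: past demands together with all seeds. Hence the choice of content
  -- in period `t + 1` belongs to the history, while the demand of that period is independent of it.
  set H := fun (t : ℕ) ω => ((fun i : Finset.range (t + 1) => d i ω), fun t => ξ t ω) with hH
  have hHm : ∀ t, Measurable[MeasurableSpace.comap (H t) inferInstance] (H t) :=
    fun t => comap_measurable (H t)
  have hdH : ∀ t, ∀ i ≤ t, Measurable[MeasurableSpace.comap (H t) inferInstance] (d i) :=
    fun t i hi => (measurable_pi_apply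
      (⟨i, Finset.mem_range.2 (by omega)⟩ : Finset.range (t + 1))).comp
        (measurable_fst.comp (hHm t))
  have hξH : ∀ t i, Measurable[MeasurableSpace.comap (H t) inferInstance] (ξ i) :=
    fun t i => (measurable_pi_apply i).comp (measurable_snd.comp (hHm t))
  have hHm' : ∀ t, Measurable (H t) := fun t =>
    (measurable_pi_lambda (fun ω (i : Finset.range (t + 1)) => d i ω)
      fun i => henv.measurable_demand i).prodMk hξm
  have key := measureReal_skipping_deviation_le (P := P) (μ₀ := θ f)
    (𝓗 := fun t => MeasurableSpace.comap (H t) inferInstance)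
    (X := fun i ω => d (i + 1) ω f)
    (e := fun i => {ω | f ∈ (cucbRun n init solve d ξ (i + 1) ω).cache})
    (fun t => (hHm' t).comap_le) (fun t i hi => ?_)
    (fun t i hi => (measurable_pi_apply f).comp (hdH t (i + 1) hi))
    (fun t => (measurable_pi_apply f).comp (henv.measurable_demand _))
    (fun t => ?_) (fun t => henv.demand_mem _ f) (fun t => henv.demand_mean _ f) t
  · refine (measureReal_mono (fun ω hω => ?_)).trans key
    have hpos : 0 < (cucbRun n init solve d ξ t ω).plays f := cucbsc_plays_pos _ _ _ _ _ hinit ht f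
    have e1 : ((cucbRun n init solve d ξ t ω).plays f : ℝ) = ∑ i ∈ Finset.range t,
        if f ∈ (cucbRun n init solve d ξ (i + 1) ω).cache then 1 else 0 :=
      cucbsc_plays_eq n init solve _ _ t f
    have e2 : (cucbRun n init solve d ξ t ω).mean f * (cucbRun n init solve d ξ t ω).plays f =
        ∑ i ∈ Finset.range t,
          if f ∈ (cucbRun n init solve d ξ (i + 1) ω).cache then d (i + 1) ω f else 0 :=
      cucbsc_mean_mul_plays n init solve _ _ t f
    refine ⟨(cucbRun n init solve d ξ t ω).plays f, hpos, cucbsc_plays_le _ _ _ _ _ t f, ?_, ?_⟩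
    · simp only [Set.indicator_apply, Set.mem_ofPred_eq]
      exact e1.symm
    · have e3 : ∑ i ∈ Finset.range t,
          {ω | f ∈ (cucbRun n init solve d ξ (i + 1) ω).cache}.indicator
            (fun ω => d (i + 1) ω f - θ f) ω
          = (cucbRun n init solve d ξ t ω).plays f
            * ((cucbRun n init solve d ξ t ω).mean f - θ f) := by
        have : ∀ i, {ω | f ∈ (cucbRun n init solve d ξ (i + 1) ω).cache}.indicator
            (fun ω => d (i + 1) ω f - θ f) ω =
            (if f ∈ (cucbRun n init solve d ξ (i + 1) ω).cache then d (i + 1) ω f else 0)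
            - θ f * if f ∈ (cucbRun n init solve d ξ (i + 1) ω).cache then 1 else 0 := by
          intro i
          simp only [Set.indicator_apply, Set.mem_ofPred_eq]
          split_ifs <;> simp
        simp_rw [this]
        rw [Finset.sum_sub_distrib, ← Finset.mul_sum]
        rw [← e1, ← e2]
        ring
      rw [e3, abs_mul, Nat.abs_cast]
      exact mul_le_mul_of_nonneg_left hω (Nat.cast_nonneg _)
  · have hs := @_root_.cucbRun_isMeasurable Ω (MeasurableSpace.comap (H t) inferInstance) F Seed _
      n init solve d ξ hsolve.measurable i (fun k hk => hdH t k (by omega)) fun k _ => hξH t k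
    exact @measurableSet_of_forall_fiber Ω (MeasurableSpace.comap (H t) inferInstance) _ _ _
      (@cucbRun_cache_succ_measurable Ω (MeasurableSpace.comap (H t) inferInstance) F Seed _
        n init solve d ξ hsolve.measurable i hs (hξH t _)) fun A => f ∈ A
  · refine indep_of_indep_of_le_right
      (henv.demand_indep.indep_history henv.measurable_demand hξm henv.indep t) ?_
    exact measurable_iff_comap_le.1 ((measurable_pi_apply f).comp (comap_measurable _))

/-- In a switching period the solver succeeds and yet returns a bad content only if some file of
this content has been observed rarely, up to an event of small probability. -/
lemma IsEnvironment.measureReal_success_bad_le (henv : IsEnvironment P ν θ d ξ)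
    (hsolve : m.IsSolver α β ν solve) (hinit : m.IsInit init) (hα : 0 ≤ α) {g : ℝ ≃ₗ[ℝ] ℝ}
    (hg : m.IsRewardModulus g) (hgpos : 0 < g.symm (m.gapL α θ)) {t T : ℕ} (ht : F ≤ t)
    (hT : t + 1 ≤ T) :
    P.real ({ω | α * m.opt ((cucbRun n init solve d ξ t ω).perturbed (t + 1)) ≤
      m.reward ((cucbRun n init solve d ξ t ω).perturbed (t + 1))
        (cucbRun n init solve d ξ (t + 1) ω).cache} ∩
      {ω | (cucbRun n init solve d ξ (t + 1) ω).cache ∈ m.bad α θ}) ≤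
    P.real {ω | ∃ f, f ∈ (cucbRun n init solve d ξ (t + 1) ω).cache ∧
      ((cucbRun n init solve d ξ t ω).plays f : ℝ)
        ≤ 6 * Real.log T / g.symm (m.gapL α θ) ^ 2} + 2 * F / ((t + 1 : ℕ) : ℝ) ^ 2 := by
  set gi := g.symm (m.gapL α θ) with hgi
  have hdev : P.real (⋃ f ∈ (Finset.univ : Finset (Fin F)), {ω | √(3 * Real.log (t + 1 : ℕ) /
      (2 * (cucbRun n init solve d ξ t ω).plays f)) ≤
      |(cucbRun n init solve d ξ t ω).mean f - θ f|}) ≤ 2 * F / ((t + 1 : ℕ) : ℝ) ^ 2 := by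
    refine (measureReal_biUnion_finset_le _ _).trans ((Finset.sum_le_card_nsmul _ _ _ fun f _ =>
      henv.measureReal_mean_deviation_le hsolve hinit ht f).trans (le_of_eq ?_))
    rw [Finset.card_univ, Fintype.card_fin, nsmul_eq_mul]
    ring
  refine (measureReal_mono ?_).trans ((measureReal_union_le _ _).trans
    (add_le_add_right hdev _))
  rintro ω ⟨hS, hB⟩
  by_contra hcon
  simp only [Set.mem_union, Set.mem_ofPred_eq, Set.mem_iUnion, Finset.mem_univ, exists_prop,
    true_and, not_or, not_exists, not_and, not_le] at hcon
  obtain ⟨h1, h2⟩ := hcon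
  refine CacheModel.not_bad_of_close hg hα (θ := θ) (fun f => ?_) (fun f hf => ?_) hS hB
  · have := (abs_lt.1 (h2 f)).1
    simp only [CucbState.perturbed]
    linarith
  · have h3 := (abs_lt.1 (h2 f)).2
    have h4 := h1 f hf
    simp only [CucbState.perturbed]
    set p : ℝ := ((cucbRun n init solve d ξ t ω).plays f : ℝ)
    have hL0 : 0 ≤ Real.log (t + 1 : ℕ) := Real.log_natCast_nonneg _
    -- The threshold uses the horizon `T`, so that one value of `ℓ` serves all blocks in the
    -- charging argument.
    have hLT : Real.log (t + 1 : ℕ) ≤ Real.log T :=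
      Real.log_le_log (by positivity) (by exact_mod_cast hT)
    have hp : 0 < p := lt_of_le_of_lt (by have := hL0.trans hLT; positivity) h4
    -- The perturbed estimate exceeds `θ f` by less than two radii, so a radius below `gi / 2`
    -- suffices; this is where `6 log T / gi²` comes from.
    have h5 : √(3 * Real.log (t + 1 : ℕ) / (2 * p)) < gi / 2 := by
      rw [Real.sqrt_lt' (by positivity), div_lt_iff₀ (by positivity)]
      rw [div_lt_iff₀ (by positivity)] at h4
      nlinarith
    linarith

end Environment

/-! ### Summability of the failure probabilities. -/

section Series

lemma sum_range_one_div_succ_sq_le (J : ℕ) :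
    ∑ j ∈ Finset.range J, 1 / ((j : ℝ) + 1) ^ 2 ≤ Real.pi ^ 2 / 6 := by
  have h := sum_le_hasSum (Finset.range (J + 1)) (fun i _ => by positivity) hasSum_zeta_two
  rw [Finset.sum_range_succ'] at h
  simpa using h

variable {F : ℕ} {γ : ℝ}

lemma sq_le_switchTime (hγ : 2 + 1 / √((F : ℝ) + 1) ≤ γ) (j : ℕ) :
    ((j : ℝ) + 1) ^ 2 ≤ switchTime F γ j := by
  have h1 : (1 : ℝ) ≤ √((F : ℝ) + 1) := Real.one_le_sqrt.2 (by simp)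
  have h2 := sqrt_switchTime_ge hγ j
  exact (Real.le_sqrt' (by positivity)).1 (by linarith)

lemma sum_one_div_switchTime_sq_le (hγ : 2 + 1 / √((F : ℝ) + 1) ≤ γ) (J : ℕ) :
    ∑ j ∈ Finset.range J, 1 / (switchTime F γ j : ℝ) ^ 2 ≤ Real.pi ^ 2 / 6 := by
  refine le_trans (Finset.sum_le_sum fun j _ => ?_) (sum_range_one_div_succ_sq_le J)
  have h := sq_le_switchTime hγ j
  have hj : (0 : ℝ) ≤ j := Nat.cast_nonneg j
  gcongr
  nlinarith

/-- The crude bound `Δ(j) ≤ (γ+1) n_j` cancels one power of `n_j`, and `n_j ≥ (j+1)²` makes the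
remaining series converge. -/
lemma sum_blockLen_div_switchTime_sq_le (hγ : 2 + 1 / √((F : ℝ) + 1) ≤ γ) (J : ℕ) :
    ∑ j ∈ Finset.range J, blockLen γ (switchTime F γ j) * (1 / (switchTime F γ j : ℝ) ^ 2)
      ≤ (γ + 1) * (Real.pi ^ 2 / 6) := by
  have hγ0 : 0 ≤ γ := le_trans (by positivity) hγ
  refine le_trans (Finset.sum_le_sum (g := fun j : ℕ => (γ + 1) * (1 / ((j : ℝ) + 1) ^ 2))
    fun j _ => ?_) ?_
  · have h := sq_le_switchTime hγ j
    set N : ℝ := (switchTime F γ j : ℝ) with hN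
    have hj : (0 : ℝ) ≤ j := Nat.cast_nonneg j
    have hN1 : 1 ≤ N := by nlinarith
    have h2 : (blockLen γ (switchTime F γ j) : ℝ) ≤ (γ + 1) * N := by
      have h3 := blockLen_le hγ0 (switchTime F γ j)
      have h4 : √N ≤ N := Real.sqrt_le_iff.2 ⟨by linarith, by nlinarith⟩
      nlinarith
    calc _ ≤ (γ + 1) * N * (1 / N ^ 2) := by gcongr
      _ = (γ + 1) * (1 / N) := by field_simp
      _ ≤ _ := by gcongr
  · rw [← Finset.mul_sum]
    exact mul_le_mul_of_nonneg_left (sum_range_one_div_succ_sq_le J) (by linarith)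

end Series

/-! ### Passing from pathwise bounds to expectations. -/

section Expectation

variable {Ω : Type*} [MeasurableSpace Ω] {P : Measure Ω}

lemma integrable_comp_of_forall_fiber [IsFiniteMeasure P] {ι : Type*} [Finite ι] {c : Ω → ι}
    (hc : ∀ a, MeasurableSet {ω | c ω = a}) (h : ι → ℝ) : Integrable (fun ω => h (c ω)) P := by
  obtain ⟨C, hC⟩ := (Set.finite_range fun a => ‖h a‖).bddAbove
  exact Integrable.of_bound (measurable_comp_of_forall_fiber hc h).aestronglyMeasurable C
    (ae_of_all _ fun ω => hC ⟨c ω, rfl⟩)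

open Classical in
/-- A linear combination of probabilities is bounded by a pointwise bound of the corresponding
combination of indicators. -/
lemma sum_mul_measureReal_le [IsProbabilityMeasure P] {E : ℕ → Set Ω}
    (hE : ∀ j, MeasurableSet (E j)) (a : ℕ → ℝ) (J : ℕ) {K : ℝ}
    (h : ∀ ω, ∑ j ∈ Finset.range J, (if ω ∈ E j then a j else 0) ≤ K) :
    ∑ j ∈ Finset.range J, a j * P.real (E j) ≤ K := by
  have hint : ∀ j, Integrable (fun ω => if ω ∈ E j then a j else 0) P := fun j =>
    (integrable_const (a j)).indicator (hE j)
  have e : ∀ j, a j * P.real (E j) = ∫ ω, (if ω ∈ E j then a j else 0) ∂P := fun j => by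
    have := integral_indicator_const (μ := P) (a j) (hE j)
    rw [smul_eq_mul, mul_comm] at this
    exact this.symm
  simp_rw [e]
  rw [← integral_finsetSum _ fun j _ => hint j]
  calc _ ≤ ∫ _ω, K ∂P :=
        integral_mono (integrable_finsetSum _ fun j _ => hint j) (integrable_const K) h
    _ = K := by simp

end Expectation

/-! ### Probabilities of bad contents, expected rewards and costs. -/

section Cucbsc

variable {F : ℕ} {m : CacheModel F} {Ω Seed : Type*} [mΩ : MeasurableSpace Ω]
  [MeasurableSpace Seed] {P : Measure Ω} {ν : Measure Seed} {θ : Fin F → ℝ}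
  {d : ℕ → Ω → Fin F → ℝ} {ξ : ℕ → Ω → Seed} {α β : ℝ}
  {solve : (Fin F → ℝ) → Seed → Finset (Fin F)} {init : ℕ → Finset (Fin F)} {n : ℕ → ℕ} {γ : ℝ}

variable (m n init solve d ξ α) in
/-- The event that the content of period `t` is `α`-optimal for the perturbed estimates. -/
def solverSuccess (t : ℕ) : Set Ω :=
  {ω | α * m.opt ((cucbRun n init solve d ξ (t - 1) ω).perturbed t) ≤
    m.reward ((cucbRun n init solve d ξ (t - 1) ω).perturbed t)
      (cucbRun n init solve d ξ t ω).cache}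

variable (m n init solve d ξ α θ) in
/-- The event that the content of period `t` is bad. -/
def contentBad (t : ℕ) : Set Ω := {ω | (cucbRun n init solve d ξ t ω).cache ∈ m.bad α θ}

variable (n init solve d ξ) in
/-- The event that some file in the content of period `t` was cached at most `ℓ` times before. -/
def rarelyCached (ℓ : ℝ) (t : ℕ) : Set Ω :=
  {ω | ∃ f, f ∈ (cucbRun n init solve d ξ t ω).cache ∧
    ((cucbRun n init solve d ξ (t - 1) ω).plays f : ℝ) ≤ ℓ}

lemma IsEnvironment.ae_feasible (henv : IsEnvironment P ν θ d ξ) (hsolve : m.IsSolver α β ν solve)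
    (hinit : m.IsInit init) (hemp : m.Feasible ∅) :
    ∀ᵐ ω ∂P, ∀ t, m.Feasible (cucbRun n init solve d ξ t ω).cache := by
  filter_upwards [henv.ae_nonneg] with ω hω t
  exact cucbsc_feasible _ _ _ _ _ hinit hemp hsolve.feasible hω t

lemma IsEnvironment.measurableSet_solverSuccess (henv : IsEnvironment P ν θ d ξ)
    (hsolve : m.IsSolver α β ν solve) (hemp : m.Feasible ∅) (hα : 0 ≤ α) (t : ℕ) :
    MeasurableSet (solverSuccess m d ξ α solve init n t) := by
  have hv := (henv.cucbRun_isMeasurable (n := n) (init := init) hsolve (t - 1)).perturbed t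
  have hc := (henv.cucbRun_isMeasurable (n := n) (init := init) hsolve t).cache
  have : solverSuccess m d ξ α solve init n t =
      ⋃ A : Finset (Fin F), {ω | (cucbRun n init solve d ξ t ω).cache = A} ∩
        ⋂ B : {B // m.Feasible B},
          {ω | α * m.reward ((cucbRun n init solve d ξ (t - 1) ω).perturbed t) B ≤
            m.reward ((cucbRun n init solve d ξ (t - 1) ω).perturbed t) A} := by
    ext ω
    simp [solverSuccess, m.mul_opt_le_iff hemp hα]
  rw [this]
  refine MeasurableSet.iUnion fun A => (hc A).inter (MeasurableSet.iInter fun B => ?_)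
  exact measurableSet_le (((m.measurable_reward B).comp hv).const_mul α)
    ((m.measurable_reward A).comp hv)

lemma IsEnvironment.measurableSet_contentBad (henv : IsEnvironment P ν θ d ξ)
    (hsolve : m.IsSolver α β ν solve) (t : ℕ) :
    MeasurableSet (contentBad m θ d ξ α solve init n t) :=
  measurableSet_of_forall_fiber (henv.cucbRun_isMeasurable hsolve t).cache
    fun A => A ∈ m.bad α θ

lemma IsEnvironment.measurableSet_rarelyCached (henv : IsEnvironment P ν θ d ξ)
    (hsolve : m.IsSolver α β ν solve) (ℓ : ℝ) (t : ℕ) :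
    MeasurableSet (rarelyCached d ξ solve init n ℓ t) := by
  have : rarelyCached d ξ solve init n ℓ t = ⋃ f : Fin F,
      {ω | f ∈ (cucbRun n init solve d ξ t ω).cache} ∩
        {ω | ((cucbRun n init solve d ξ (t - 1) ω).plays f : ℝ) ≤ ℓ} := by
    ext ω
    simp [rarelyCached]
  rw [this]
  refine MeasurableSet.iUnion fun f => MeasurableSet.inter ?_ ?_
  · exact measurableSet_of_forall_fiber (henv.cucbRun_isMeasurable hsolve t).cache fun A => f ∈ A
  · exact measurableSet_le (measurable_from_top.comp
      ((henv.cucbRun_isMeasurable hsolve (t - 1)).plays f)) measurable_const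

variable [IsProbabilityMeasure P]

/-- The weighted number of switching periods whose content has a rarely cached file. -/
lemma IsEnvironment.sum_mul_measureReal_rarelyCached_le (henv : IsEnvironment P ν θ d ξ)
    (hsolve : m.IsSolver α β ν solve) (hinit : m.IsInit init) (hγ : 0 < γ) {a : ℕ → ℝ}
    (ha : ∀ j, 0 ≤ a j) (hle : ∀ j, a j ≤ blockLen γ (switchTime F γ j)) {ℓ c D : ℝ} (J : ℕ)
    (hD : ∀ j < J, a j ≤ D) (hc : c ≤ 1) (hc' : c ≤ ℓ + D) :
    ∑ j ∈ Finset.range J,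
      a j * P.real (rarelyCached d ξ solve init (switchTime F γ) ℓ (switchTime F γ j))
      ≤ F * (ℓ + D - c) := by
  refine sum_mul_measureReal_le
    (fun j => henv.measurableSet_rarelyCached hsolve ℓ _) a J fun ω => ?_
  -- The weights may be smaller than the block lengths; the counters grow at least as fast as the
  -- charges.
  have key := sum_le_of_counters (ι := Fin F) (a := a)
    (τ := fun j f =>
      ((cucbRun (switchTime F γ) init solve d ξ (switchTime F γ j - 1) ω).plays f : ℝ))
    (ℓ := ℓ) (c := c) (D := D)
    (q := fun j f => f ∈ (cucbRun (switchTime F γ) init solve d ξ (switchTime F γ j) ω).cache)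
    ha (fun f i j hij => ?_) (fun j f hf => ?_) J hD (fun f => ?_) hc'
  · rw [Fintype.card_fin] at key
    convert key using 3
    rfl
  · have := (switchTime_strictMono F hγ).monotone hij
    exact Nat.cast_le.2 (cucbsc_plays_mono (switchTime F γ) init solve (fun i => d i ω)
      (fun i => ξ i ω) f (by omega : switchTime F γ i - 1 ≤ switchTime F γ j - 1))
  · have h1 := cucbsc_plays_switchTime_succ init solve (fun i => d i ω) (fun i => ξ i ω) hγ j f
    have hf' : f ∈ (cucbsc (switchTime F γ) init solve (fun i => d i ω) (fun i => ξ i ω)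
      (switchTime F γ j)).cache := hf
    rw [if_pos hf'] at h1
    simp only [cucbRun]
    rw [h1]
    push_cast
    have := hle j
    linarith
  -- The initialization has cached every file at least once, so counters start at `1`.
  · refine hc.trans ?_
    have := cucbsc_plays_pos (switchTime F γ) init solve (fun i => d i ω) (fun i => ξ i ω) hinit
      (t := switchTime F γ 0 - 1) (by simp [switchTime]) f
    exact_mod_cast this

/-- The weighted number of switching periods in which the solver succeeds, but the content is
bad. -/
lemma IsEnvironment.sum_mul_measureReal_success_bad_le (henv : IsEnvironment P ν θ d ξ)
    (hsolve : m.IsSolver α β ν solve) (hinit : m.IsInit init) (hα : 0 ≤ α) {g : ℝ ≃ₗ[ℝ] ℝ}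
    (hg : m.IsRewardModulus g) (hgpos : 0 < g.symm (m.gapL α θ)) (hγ : 0 < γ) {a : ℕ → ℝ}
    (ha : ∀ j, 0 ≤ a j) (hle : ∀ j, a j ≤ blockLen γ (switchTime F γ j)) {c D : ℝ} {J T : ℕ}
    (hT : switchTime F γ J ≤ T) (hD : ∀ j < J + 1, a j ≤ D) (hc : c ≤ 1) (hD' : c ≤ D) :
    ∑ j ∈ Finset.range (J + 1),
      a j * P.real (solverSuccess m d ξ α solve init (switchTime F γ) (switchTime F γ j) ∩
        contentBad m θ d ξ α solve init (switchTime F γ) (switchTime F γ j))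
      ≤ F * (6 * Real.log T / g.symm (m.gapL α θ) ^ 2 + D - c)
        + 2 * F * ∑ j ∈ Finset.range (J + 1), a j * (1 / (switchTime F γ j : ℝ) ^ 2) := by
  have hℓ : 0 ≤ 6 * Real.log T / g.symm (m.gapL α θ) ^ 2 := by
    have : 0 ≤ Real.log T := Real.log_natCast_nonneg T
    positivity
  refine le_trans ?_ (add_le_add_left (henv.sum_mul_measureReal_rarelyCached_le hsolve hinit hγ
    ha hle (J + 1) hD hc (by linarith)) _)
  rw [Finset.mul_sum, ← Finset.sum_add_distrib]
  refine Finset.sum_le_sum fun j hj => ?_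
  have hF := le_switchTime F γ j
  obtain ⟨t, ht⟩ : ∃ t, switchTime F γ j = t + 1 := ⟨switchTime F γ j - 1, by omega⟩
  have hjT : t + 1 ≤ T := by
    rw [← ht]
    exact ((switchTime_strictMono F hγ).monotone
      (Nat.lt_succ_iff.1 (Finset.mem_range.1 hj))).trans hT
  have key := henv.measureReal_success_bad_le (n := switchTime F γ) hsolve hinit hα hg hgpos
    (by omega : F ≤ t) hjT
  rw [ht]
  calc _ ≤ a j * _ := mul_le_mul_of_nonneg_left key (ha j)
    _ = _ := by
      rw [rarelyCached, Nat.add_sub_cancel]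
      ring

/-- Expected reward in a switching period. -/
lemma IsEnvironment.le_integral_reward [IsProbabilityMeasure ν] (henv : IsEnvironment P ν θ d ξ)
    (hsolve : m.IsSolver α β ν solve) (hinit : m.IsInit init) (hemp : m.Feasible ∅)
    (hα : 0 ≤ α) (t : ℕ) (hF : F < t) (hn : ∃ j, n j = t) :
    α * β * m.opt θ - m.gapU α θ * P.real (solverSuccess m d ξ α solve init n t ∩
        contentBad m θ d ξ α solve init n t)
      ≤ ∫ ω, m.reward θ (cucbRun n init solve d ξ t ω).cache ∂P := by
  obtain ⟨t, rfl⟩ : ∃ s, t = s + 1 := ⟨t - 1, by omega⟩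
  set S := solverSuccess m d ξ α solve init n (t + 1) with hS
  set B := contentBad m θ d ξ α solve init n (t + 1) with hB
  have hSm : MeasurableSet S := henv.measurableSet_solverSuccess hsolve hemp hα (t + 1)
  have hBm : MeasurableSet B := henv.measurableSet_contentBad hsolve (t + 1)
  have hSP : β ≤ P.real S := henv.le_measureReal_solver_success hsolve hemp hα hF hn
  have hopt := m.opt_nonneg hemp henv.mean_nonneg
  have hint : Integrable (fun ω => S.indicator (fun _ => α * m.opt θ) ω
      - (S ∩ B).indicator (fun _ => m.gapU α θ) ω) P :=
    ((integrable_const _).indicator hSm).sub ((integrable_const _).indicator (hSm.inter hBm))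
  have h1 : ∫ ω, (S.indicator (fun _ => α * m.opt θ) ω
      - (S ∩ B).indicator (fun _ => m.gapU α θ) ω) ∂P
      = P.real S * (α * m.opt θ) - P.real (S ∩ B) * m.gapU α θ := by
    rw [integral_sub ((integrable_const _).indicator hSm)
      ((integrable_const _).indicator (hSm.inter hBm)), integral_indicator_const _ hSm,
      integral_indicator_const _ (hSm.inter hBm), smul_eq_mul, smul_eq_mul]
  -- Pointwise, the reward is at least `α r_opt` on success, less `Δ_u` if the content is bad, and
  -- at least `0` on failure.
  have h2 : P.real S * (α * m.opt θ) - P.real (S ∩ B) * m.gapU α θ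
      ≤ ∫ ω, m.reward θ (cucbRun n init solve d ξ (t + 1) ω).cache ∂P := by
    rw [← h1]
    refine integral_mono_ae hint (integrable_comp_of_forall_fiber
      (henv.cucbRun_isMeasurable hsolve (t + 1)).cache _) ?_
    filter_upwards [henv.ae_feasible (n := n) hsolve hinit hemp] with ω hfeas
    have hr := m.reward_nonneg henv.mean_nonneg (cucbRun n init solve d ξ (t + 1) ω).cache
    by_cases hωS : ω ∈ S
    · by_cases hωB : ω ∈ B
      · rw [Set.indicator_of_mem hωS, Set.indicator_of_mem (Set.mem_inter hωS hωB)]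
        exact m.le_reward_of_bad hωB
      · rw [Set.indicator_of_mem hωS, Set.indicator_of_notMem fun h => hωB h.2, sub_zero]
        by_contra hlt
        exact hωB ⟨hfeas (t + 1), not_le.1 hlt⟩
    · rw [Set.indicator_of_notMem hωS, Set.indicator_of_notMem fun h => hωS h.1, sub_zero]
      exact hr
  have h3 : β * (α * m.opt θ) ≤ P.real S * (α * m.opt θ) :=
    mul_le_mul_of_nonneg_right hSP (mul_nonneg hα hopt)
  linarith

/-- Expected regret in a period of the initialization. -/
lemma IsEnvironment.regret_le_gapU (henv : IsEnvironment P ν θ d ξ)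
    (hsolve : m.IsSolver α β ν solve) (hinit : m.IsInit init) (hemp : m.Feasible ∅)
    (hα : 0 ≤ α) (hβ : β ≤ 1) (hbad : (m.bad α θ).Nonempty) (t : ℕ) :
    α * β * m.opt θ - ∫ ω, m.reward θ (cucbRun n init solve d ξ t ω).cache ∂P
      ≤ m.gapU α θ := by
  have hopt := m.opt_nonneg hemp henv.mean_nonneg
  have h1 : α * m.opt θ - m.gapU α θ
      ≤ ∫ ω, m.reward θ (cucbRun n init solve d ξ t ω).cache ∂P := by
    calc _ = ∫ _ω, (α * m.opt θ - m.gapU α θ) ∂P := by simp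
      _ ≤ _ := by
        refine integral_mono_ae (integrable_const _) (integrable_comp_of_forall_fiber
          (henv.cucbRun_isMeasurable hsolve t).cache _) ?_
        filter_upwards [henv.ae_feasible (n := n) hsolve hinit hemp] with ω hfeas
        by_cases hB : (cucbRun n init solve d ξ t ω).cache ∈ m.bad α θ
        · exact m.le_reward_of_bad hB
        · have := m.gapU_pos hbad
          by_contra hlt
          exact hB ⟨hfeas t, by linarith [not_le.1 hlt]⟩
  have h2 : α * β * m.opt θ ≤ α * m.opt θ := by
    have := mul_le_mul_of_nonneg_left hβ (mul_nonneg hα hopt)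
    linarith
  linarith

lemma IsEnvironment.integrable_cost (henv : IsEnvironment P ν θ d ξ)
    (hsolve : m.IsSolver α β ν solve) (s t : ℕ) :
    Integrable (fun ω => m.cost (cucbRun n init solve d ξ s ω).cache
      (cucbRun n init solve d ξ t ω).cache) P := by
  refine integrable_comp_of_forall_fiber (c := fun ω => ((cucbRun n init solve d ξ s ω).cache,
    (cucbRun n init solve d ξ t ω).cache)) (fun a => ?_) fun a => m.cost a.1 a.2
  have : {ω | ((cucbRun n init solve d ξ s ω).cache, (cucbRun n init solve d ξ t ω).cache) = a}
      = {ω | (cucbRun n init solve d ξ s ω).cache = a.1} ∩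
        {ω | (cucbRun n init solve d ξ t ω).cache = a.2} := by
    ext ω
    simp [Prod.ext_iff]
  rw [this]
  exact ((henv.cucbRun_isMeasurable hsolve s).cache _).inter
    ((henv.cucbRun_isMeasurable hsolve t).cache _)

lemma IsEnvironment.integral_cost_le_costU (henv : IsEnvironment P ν θ d ξ)
    (hsolve : m.IsSolver α β ν solve) (hinit : m.IsInit init) (hemp : m.Feasible ∅) (s t : ℕ) :
    ∫ ω, m.cost (cucbRun n init solve d ξ s ω).cache (cucbRun n init solve d ξ t ω).cache ∂P
      ≤ m.costU := by
  calc _ ≤ ∫ _ω, m.costU ∂P := by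
        refine integral_mono_ae (henv.integrable_cost hsolve s t) (integrable_const _) ?_
        filter_upwards [henv.ae_feasible (n := n) hsolve hinit hemp] with ω hfeas
        exact m.cost_le_costU (hfeas s) (hfeas t)
    _ = m.costU := by simp

/-- Expected cost of passing between two random contents, in terms of the probabilities that they
are bad. -/
lemma IsEnvironment.integral_cost_le (henv : IsEnvironment P ν θ d ξ)
    (hsolve : m.IsSolver α β ν solve) (hinit : m.IsInit init) (hemp : m.Feasible ∅) (s t : ℕ) :
    ∫ ω, m.cost (cucbRun n init solve d ξ s ω).cache (cucbRun n init solve d ξ t ω).cache ∂P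
      ≤ m.costL α θ + (m.costU - m.costL α θ) *
        (P.real (contentBad m θ d ξ α solve init n s)
          + P.real (contentBad m θ d ξ α solve init n t)) := by
  have hUL := m.costL_le_costU α θ
  have hBm := fun t => henv.measurableSet_contentBad (n := n) (init := init) hsolve t
  set B := contentBad m θ d ξ α solve init n with hB
  have hi : ∀ t, Integrable (fun ω => (B t).indicator (fun _ => m.costU - m.costL α θ) ω) P :=
    fun t => (integrable_const _).indicator (hBm t)
  -- The excess `M_u - M_l` is added once per bad content; if both are bad it is counted twice,
  -- which only weakens the bound.
  calc _ ≤ ∫ ω, (m.costL α θ + ((B s).indicator (fun _ => m.costU - m.costL α θ) ω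
          + (B t).indicator (fun _ => m.costU - m.costL α θ) ω)) ∂P := by
        refine integral_mono_ae (henv.integrable_cost hsolve s t)
          ((integrable_const _).add ((hi s).add (hi t))) ?_
        filter_upwards [henv.ae_feasible (n := n) hsolve hinit hemp] with ω hfeas
        have hU := m.cost_le_costU (hfeas s) (hfeas t)
        by_cases hs : ω ∈ B s <;> by_cases ht : ω ∈ B t <;> simp only [hs, ht, not_false_eq_true,
          Set.indicator_of_mem, Set.indicator_of_notMem]
        · linarith
        · linarith
        · linarith
        · have hgood : ∀ t, ω ∉ B t →
              (cucbRun n init solve d ξ t ω).cache ∈ m.good α θ := fun t ht =>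
            ⟨hfeas t, not_lt.1 fun h => ht ⟨hfeas t, h⟩⟩
          have := m.cost_le_costL (hgood s hs) (hgood t ht)
          linarith
    _ = _ := by
        have hst : Integrable (fun ω => (B s).indicator (fun _ => m.costU - m.costL α θ) ω
          + (B t).indicator (fun _ => m.costU - m.costL α θ) ω) P := (hi s).add (hi t)
        rw [integral_add (integrable_const _) hst, integral_add (hi s) (hi t),
          integral_indicator_const _ (hBm s), integral_indicator_const _ (hBm t)]
        simp
        ring

/-- In a switching period the content is bad with probability at most `1 - β`, up to the event
that the solver succeeds and the content is bad nonetheless. -/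
lemma IsEnvironment.measureReal_contentBad_le [IsProbabilityMeasure ν]
    (henv : IsEnvironment P ν θ d ξ) (hsolve : m.IsSolver α β ν solve) (hemp : m.Feasible ∅)
    (hα : 0 ≤ α) (t : ℕ) (hF : F < t) (hn : ∃ j, n j = t) :
    P.real (contentBad m θ d ξ α solve init n t) ≤
      P.real (solverSuccess m d ξ α solve init n t ∩ contentBad m θ d ξ α solve init n t)
        + (1 - β) := by
  have hSm := henv.measurableSet_solverSuccess (n := n) (init := init) hsolve hemp hα t
  have hSP : β ≤ P.real (solverSuccess m d ξ α solve init n t) := by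
    obtain ⟨t, rfl⟩ : ∃ s, t = s + 1 := ⟨t - 1, by omega⟩
    exact henv.le_measureReal_solver_success hsolve hemp hα hF hn
  set S := solverSuccess m d ξ α solve init n t
  set B := contentBad m θ d ξ α solve init n t
  have h1 : P.real B ≤ P.real ((S ∩ B) ∪ Sᶜ) := measureReal_mono fun ω hω => by
    by_cases h : ω ∈ S
    · exact Or.inl ⟨h, hω⟩
    · exact Or.inr h
  have h2 := measureReal_union_le (μ := P) (S ∩ B) Sᶜ
  rw [probReal_compl_eq_one_sub hSm] at h2
  linarith

end Cucbsc

/-! ### Both regrets as sums over blocks, and their estimates. -/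

section RegretBounds

variable {F : ℕ} {m : CacheModel F} {Ω Seed : Type*} [mΩ : MeasurableSpace Ω]
  [MeasurableSpace Seed] {P : Measure Ω} [IsProbabilityMeasure P] {ν : Measure Seed} {θ : Fin F → ℝ} {d : ℕ → Ω → Fin F → ℝ} {ξ : ℕ → Ω → Seed} {α β : ℝ}
  {solve : (Fin F → ℝ) → Seed → Finset (Fin F)} {init : ℕ → Finset (Fin F)} {γ : ℝ}

/-- Sampling regret over complete blocks. -/
lemma IsEnvironment.samplingRegret_le_sum [IsProbabilityMeasure ν]
    (henv : IsEnvironment P ν θ d ξ)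
    (hsolve : m.IsSolver α β ν solve) (hinit : m.IsInit init) (hemp : m.Feasible ∅)
    (hα : 0 ≤ α) (hβ : β ≤ 1) (hbad : (m.bad α θ).Nonempty) (hγ : 0 < γ) {t J : ℕ}
    (ht : t < switchTime F γ J) :
    samplingRegret m P θ α β
      (fun i ω => (cucbRun (switchTime F γ) init solve d ξ i ω).cache) t
    ≤ m.gapU α θ * (F + ∑ j ∈ Finset.range J, blockLen γ (switchTime F γ j) *
        P.real (solverSuccess m d ξ α solve init (switchTime F γ) (switchTime F γ j) ∩
          contentBad m θ d ξ α solve init (switchTime F γ) (switchTime F γ j))) := by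
  set n := switchTime F γ with hn
  set p : ℕ → ℝ := fun j => P.real (solverSuccess m d ξ α solve init n (n j) ∩
    contentBad m θ d ξ α solve init n (n j)) with hp
  set h : ℕ → ℝ := fun i =>
    α * β * m.opt θ - ∫ ω, m.reward θ (cucbRun n init solve d ξ i ω).cache ∂P with hh
  have hΔ := (m.gapU_pos hbad).le
  have hreg : samplingRegret m P θ α β (fun i ω => (cucbRun n init solve d ξ i ω).cache) t
      = ∑ i ∈ Finset.Icc 1 t, h i := by
    rw [samplingRegret, integral_finsetSum _ fun i _ => integrable_comp_of_forall_fiber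
      (henv.cucbRun_isMeasurable hsolve i).cache _, hh, Finset.sum_sub_distrib]
    simp
    ring
  -- Positive parts allow the sum to be extended to the end of the last, incomplete block.
  have hblock : ∀ j, ∀ i ∈ Finset.Ico (n j) (n (j + 1)), max (h i) 0 ≤ m.gapU α θ * p j := by
    intro j i hi
    rw [Finset.mem_Ico] at hi
    refine max_le ?_ (mul_nonneg hΔ measureReal_nonneg)
    have h1 := henv.le_integral_reward (n := n) hsolve hinit hemp hα (n j)
      (le_switchTime F γ j) ⟨j, rfl⟩
    have h2 : ∀ ω, (cucbRun n init solve d ξ i ω).cache = (cucbRun n init solve d ξ (n j) ω).cache :=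
      fun ω => cucbsc_cache_block init solve _ _ hγ hi.1 hi.2
    simp only [hh, h2]
    linarith
  rw [hreg]
  calc ∑ i ∈ Finset.Icc 1 t, h i ≤ ∑ i ∈ Finset.Icc 1 t, max (h i) 0 :=
        Finset.sum_le_sum fun i _ => le_max_left _ _
    _ ≤ ∑ i ∈ Finset.Ico 1 (n J), max (h i) 0 :=
        Finset.sum_le_sum_of_subset_of_nonneg (fun i hi => by
          rw [Finset.mem_Icc] at hi
          rw [Finset.mem_Ico]
          omega) fun i _ _ => le_max_right _ _
    _ = ∑ i ∈ Finset.Ico 1 (F + 1), max (h i) 0 + ∑ j ∈ Finset.range J,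
          ∑ i ∈ Finset.Ico (n j) (n (j + 1)), max (h i) 0 := by
        rw [← sum_Ico_switchTime hγ, Finset.sum_Ico_consecutive _ (by omega) (le_switchTime F γ J)]
    _ ≤ F * m.gapU α θ + ∑ j ∈ Finset.range J, blockLen γ (n j) * (m.gapU α θ * p j) := by
        refine add_le_add ?_ (Finset.sum_le_sum fun j _ => ?_)
        · refine (Finset.sum_le_card_nsmul _ _ (m.gapU α θ) fun i _ => max_le
            (henv.regret_le_gapU hsolve hinit hemp hα hβ hbad i) hΔ).trans (le_of_eq ?_)
          simp
        · refine (Finset.sum_le_card_nsmul _ _ _ (hblock j)).trans (le_of_eq ?_)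
          rw [Nat.card_Ico, nsmul_eq_mul, hn, switchTime, Nat.add_sub_cancel_left]
    _ = _ := by
        rw [mul_add, Finset.mul_sum, mul_comm]
        congr 1
        exact Finset.sum_congr rfl fun j _ => by ring

/-- Expected switching cost over complete blocks. -/
lemma IsEnvironment.switchingRegret_le_sum [IsProbabilityMeasure ν]
    (henv : IsEnvironment P ν θ d ξ)
    (hsolve : m.IsSolver α β ν solve) (hinit : m.IsInit init) (hemp : m.Feasible ∅)
    (hα : 0 ≤ α) (hγ : 0 < γ) {t J : ℕ} (ht : t < switchTime F γ (J + 1)) :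
    switchingRegret m P (fun i ω => (cucbRun (switchTime F γ) init solve d ξ i ω).cache) t
    ≤ F * m.costU + J * m.costL α θ + (m.costU - m.costL α θ) *
      (2 * ∑ j ∈ Finset.range (J + 1),
        P.real (solverSuccess m d ξ α solve init (switchTime F γ) (switchTime F γ j) ∩
          contentBad m θ d ξ α solve init (switchTime F γ) (switchTime F γ j))
        + 2 * J * (1 - β)) := by
  set n := switchTime F γ with hn
  set p : ℕ → ℝ := fun j => P.real (solverSuccess m d ξ α solve init n (n j) ∩
    contentBad m θ d ξ α solve init n (n j)) with hp
  set κ : ℕ → ℝ := fun i => ∫ ω, m.cost (cucbRun n init solve d ξ i ω).cache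
    (cucbRun n init solve d ξ (i - 1) ω).cache ∂P with hκ
  have hκ0 : ∀ i, 0 ≤ κ i := fun i => integral_nonneg fun ω => m.cost_nonneg _ _
  have hκU : ∀ i, κ i ≤ m.costU := fun i => henv.integral_cost_le_costU hsolve hinit hemp i (i - 1)
  have hUL := sub_nonneg.2 (m.costL_le_costU α θ)
  have hreg : switchingRegret m P (fun i ω => (cucbRun n init solve d ξ i ω).cache) t
      = ∑ i ∈ Finset.Icc 1 t, κ i - m.cap := by
    rw [switchingRegret, integral_finsetSum _ fun i _ => henv.integrable_cost hsolve i (i - 1)]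
  have hmono := switchTime_strictMono F hγ
  have hblock : ∀ j, ∑ i ∈ Finset.Ico (n j) (n (j + 1)), κ i = κ (n j) := by
    intro j
    refine Finset.sum_eq_single_of_mem (n j)
      (Finset.mem_Ico.2 ⟨le_rfl, hmono (Nat.lt_succ_self j)⟩) fun i hi hne => ?_
    rw [Finset.mem_Ico] at hi
    have : ∀ ω, m.cost (cucbRun n init solve d ξ i ω).cache
        (cucbRun n init solve d ξ (i - 1) ω).cache = 0 := fun ω =>
      cucbsc_cost_eq_zero init solve _ _ hγ m (lt_of_le_of_ne hi.1 hne.symm) hi.2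
    simp only [hκ, this, integral_zero]
  have hB : ∀ j, P.real (contentBad m θ d ξ α solve init n (n j)) ≤ p j + (1 - β) := fun j =>
    henv.measureReal_contentBad_le hsolve hemp hα (n j) (le_switchTime F γ j) ⟨j, rfl⟩
  -- A switch replaces the content chosen at `n j` by the one chosen at `n (j + 1)`; each is bad
  -- with probability at most `p + (1 - β)`. Summing over `j` uses every `p j` at most twice.
  have hstep : ∀ j, κ (n (j + 1)) ≤ m.costL α θ
      + (m.costU - m.costL α θ) * ((p (j + 1) + p j) + 2 * (1 - β)) := by
    intro j
    have h1 : n j < n (j + 1) := hmono (Nat.lt_add_one j)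
    have h2 : ∀ ω, (cucbRun n init solve d ξ (n (j + 1) - 1) ω).cache
        = (cucbRun n init solve d ξ (n j) ω).cache := fun ω =>
      cucbsc_cache_block init solve _ _ hγ (Nat.le_sub_one_of_lt h1) (Nat.sub_one_lt_of_lt h1)
    have h3 := henv.integral_cost_le (α := α) (n := n) hsolve hinit hemp (n (j + 1)) (n j)
    simp only [hκ, h2]
    refine h3.trans (add_le_add_right (mul_le_mul_of_nonneg_left ?_ hUL) _)
    linarith [hB (j + 1), hB j]
  have hp0 : ∀ j, 0 ≤ p j := fun j => measureReal_nonneg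
  have hs1 : ∑ j ∈ Finset.range J, p j ≤ ∑ j ∈ Finset.range (J + 1), p j := by
    rw [Finset.sum_range_succ]
    linarith [hp0 J]
  have hs2 : ∑ j ∈ Finset.range J, p (j + 1) ≤ ∑ j ∈ Finset.range (J + 1), p j := by
    rw [Finset.sum_range_succ']
    linarith [hp0 0]
  have htotal : ∑ i ∈ Finset.Icc 1 t, κ i ≤ F * m.costU + m.costU + (J * m.costL α θ
      + (m.costU - m.costL α θ) * (2 * ∑ j ∈ Finset.range (J + 1), p j + 2 * J * (1 - β))) := by
    calc ∑ i ∈ Finset.Icc 1 t, κ i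
        ≤ ∑ i ∈ Finset.Ico 1 (n (J + 1)), κ i :=
          Finset.sum_le_sum_of_subset_of_nonneg (fun i hi => by
            rw [Finset.mem_Icc] at hi
            rw [Finset.mem_Ico]
            omega) fun i _ _ => hκ0 i
      _ = ∑ i ∈ Finset.Ico 1 (F + 1), κ i + ∑ j ∈ Finset.range (J + 1), κ (n j) := by
          rw [← Finset.sum_Ico_consecutive _ (by omega : 1 ≤ F + 1) (le_switchTime F γ (J + 1)),
            sum_Ico_switchTime hγ]
          congr 1
          exact Finset.sum_congr rfl fun j _ => hblock j
      _ = ∑ i ∈ Finset.Ico 1 (F + 1), κ i + κ (n 0) + ∑ j ∈ Finset.range J, κ (n (j + 1)) := by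
          rw [Finset.sum_range_succ']
          ring
      _ ≤ F * m.costU + m.costU + ∑ j ∈ Finset.range J, (m.costL α θ
            + (m.costU - m.costL α θ) * ((p (j + 1) + p j) + 2 * (1 - β))) := by
          refine add_le_add (add_le_add ?_ (hκU _)) (Finset.sum_le_sum fun j _ => hstep j)
          refine (Finset.sum_le_card_nsmul _ _ _ fun i _ => hκU i).trans (le_of_eq ?_)
          simp
      _ = F * m.costU + m.costU + (J * m.costL α θ + (m.costU - m.costL α θ) *
            ((∑ j ∈ Finset.range J, p (j + 1) + ∑ j ∈ Finset.range J, p j)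
              + 2 * J * (1 - β))) := by
          rw [Finset.sum_add_distrib, ← Finset.mul_sum, Finset.sum_add_distrib,
            Finset.sum_add_distrib]
          simp only [Finset.sum_const, Finset.card_range, nsmul_eq_mul]
          ring
      _ ≤ _ := by
          refine add_le_add_right (add_le_add_right (mul_le_mul_of_nonneg_left ?_ hUL) _) _
          linarith
  -- The subtracted capacity pays for the first switch after the initialization, since `M_u ≤ M`.
  rw [hreg]
  linarith [m.costU_le_cap hemp]

/-- This covers horizons `t ≤ F`, before any switching period. -/
lemma IsEnvironment.switchingRegret_le_mul_costU (henv : IsEnvironment P ν θ d ξ)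
    (hsolve : m.IsSolver α β ν solve) (hinit : m.IsInit init) (hemp : m.Feasible ∅)
    (n : ℕ → ℕ) (t : ℕ) :
    switchingRegret m P (fun i ω => (cucbRun n init solve d ξ i ω).cache) t ≤ t * m.costU := by
  rw [switchingRegret, integral_finsetSum _ fun i _ => henv.integrable_cost hsolve i (i - 1)]
  have h0 : 0 ≤ m.cap := by simpa [CacheModel.Feasible] using hemp
  have := Finset.sum_le_card_nsmul (Finset.Icc 1 t) _ _ fun i _ =>
    henv.integral_cost_le_costU (n := n) hsolve hinit hemp i (i - 1)
  rw [Nat.card_Icc, nsmul_eq_mul, Nat.add_sub_cancel] at this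
  linarith

/-- Logarithmic plus square root bound for the sampling regret. -/
lemma IsEnvironment.exists_samplingRegret_le [IsProbabilityMeasure ν]
    (henv : IsEnvironment P ν θ d ξ)
    (hsolve : m.IsSolver α β ν solve) (hinit : m.IsInit init) (hemp : m.Feasible ∅)
    (hα : 0 ≤ α) (hβ : β ≤ 1) (hbad : (m.bad α θ).Nonempty) {g : ℝ ≃ₗ[ℝ] ℝ}
    (hg : m.IsRewardModulus g) (hgpos : 0 < g.symm (m.gapL α θ))
    (hγ : 2 + 1 / √((F : ℝ) + 1) ≤ γ) (t : ℕ) :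
    ∃ q : ℝ, samplingRegret m P θ α β
        (fun i ω => (cucbRun (switchTime F γ) init solve d ξ i ω).cache) t ≤ m.gapU α θ * q ∧
      q ≤ F + (F * (6 * Real.log t / g.symm (m.gapL α θ) ^ 2 + (γ * √(t : ℝ) + 1))
        + 2 * F * ((γ + 1) * (Real.pi ^ 2 / 6))) := by
  have hγ0 : 0 < γ := lt_of_lt_of_le (by positivity) hγ
  have hL : 0 ≤ Real.log t := Real.log_natCast_nonneg t
  rcases Nat.lt_or_ge F t with htF | htF
  · obtain ⟨J, hJ, hJ'⟩ := exists_switchTime_le_lt hγ0 htF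
    refine ⟨_, henv.samplingRegret_le_sum hsolve hinit hemp hα hβ hbad hγ0 hJ', ?_⟩
    -- Each period of a bad block counts here, so the weights are the block lengths, all at most
    -- `γ√t + 1` up to time `t`.
    have h1 := henv.sum_mul_measureReal_success_bad_le hsolve hinit hα hg hgpos hγ0
      (a := fun j => (blockLen γ (switchTime F γ j) : ℝ)) (c := 0) (D := γ * √(t : ℝ) + 1)
      (fun j => Nat.cast_nonneg _) (fun j => le_rfl) hJ (fun j hj => ?_) zero_le_one
      (by positivity)
    · have h2 := mul_le_mul_of_nonneg_left (sum_blockLen_div_switchTime_sq_le hγ (J + 1))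
        (by positivity : (0 : ℝ) ≤ 2 * F)
      linarith
    · refine (blockLen_le hγ0.le _).trans (add_le_add_left (mul_le_mul_of_nonneg_left
        (Real.sqrt_le_sqrt (Nat.cast_le.2 ?_)) hγ0.le) _)
      exact ((switchTime_strictMono F hγ0).monotone (Nat.lt_succ_iff.1 hj)).trans hJ
  · refine ⟨_, henv.samplingRegret_le_sum hsolve hinit hemp hα hβ hbad hγ0 (J := 0)
      (Nat.lt_succ_of_le htF), ?_⟩
    rw [Finset.sum_range_zero]
    gcongr
    positivity

/-- Logarithmic plus square root bound for the switching regret. -/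
lemma IsEnvironment.exists_switchingRegret_le [IsProbabilityMeasure ν]
    (henv : IsEnvironment P ν θ d ξ)
    (hsolve : m.IsSolver α β ν solve) (hinit : m.IsInit init) (hemp : m.Feasible ∅)
    (hα : 0 ≤ α) {g : ℝ ≃ₗ[ℝ] ℝ}
    (hg : m.IsRewardModulus g) (hgpos : 0 < g.symm (m.gapL α θ))
    (hγ : 2 + 1 / √((F : ℝ) + 1) ≤ γ) {t : ℕ} (ht : 1 ≤ t) :
    ∃ J Q : ℝ, J + 1 ≤ √(t : ℝ) ∧
      Q ≤ F * (6 * Real.log t / g.symm (m.gapL α θ) ^ 2 + blockLen γ (switchTime F γ 0) - 1)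
        / blockLen γ (switchTime F γ 0) + 2 * F * (Real.pi ^ 2 / 6) ∧
      switchingRegret m P (fun i ω => (cucbRun (switchTime F γ) init solve d ξ i ω).cache) t
        ≤ F * m.costU + J * m.costL α θ
          + (m.costU - m.costL α θ) * (2 * Q + 2 * J * (1 - β)) := by
  have hγ0 : 0 < γ := lt_of_lt_of_le (by positivity) hγ
  have hL : 0 ≤ Real.log t := Real.log_natCast_nonneg t
  set δ : ℝ := (blockLen γ (switchTime F γ 0) : ℝ) with hδ
  have hδ1 : 1 ≤ δ := Nat.one_le_cast.2 (blockLen_switchTime_pos (F := F) hγ0 0)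
  rcases Nat.lt_or_ge F t with htF | htF
  · obtain ⟨J, hJ, hJ'⟩ := exists_switchTime_le_lt hγ0 htF
    refine ⟨J, _, ?_, ?_, henv.switchingRegret_le_sum hsolve hinit hemp hα hγ0 hJ'⟩
    · exact Real.le_sqrt_of_sq_le ((sq_le_switchTime hγ J).trans (by exact_mod_cast hJ))
    -- Each block counts once here. The first block is the shortest, so its length `δ` is an
    -- admissible constant weight; `c = 1` is the observation from the initialization.
    · have h1 := henv.sum_mul_measureReal_success_bad_le hsolve hinit hα hg hgpos hγ0
        (a := fun _ => δ) (c := 1) (D := δ) (fun j => Nat.cast_nonneg _)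
        (fun j => Nat.cast_le.2 (blockLen_mono hγ0.le
          ((switchTime_strictMono F hγ0).monotone (Nat.zero_le j))))
        hJ (fun j hj => le_rfl) le_rfl hδ1
      rw [← Finset.mul_sum, ← Finset.mul_sum] at h1
      have h2 := mul_le_mul_of_nonneg_left (sum_one_div_switchTime_sq_le hγ (J + 1))
        (by positivity : (0 : ℝ) ≤ 2 * F * δ)
      rw [← sub_le_iff_le_add, le_div_iff₀ (by linarith)]
      linarith
  · refine ⟨0, 0, ?_, ?_, ?_⟩
    · rw [zero_add]
      exact Real.one_le_sqrt.2 (by exact_mod_cast ht)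
    · have : 0 ≤ 6 * Real.log t / g.symm (m.gapL α θ) ^ 2 := by positivity
      have : 0 ≤ 6 * Real.log t / g.symm (m.gapL α θ) ^ 2 + δ - 1 := by linarith
      positivity
    · refine (henv.switchingRegret_le_mul_costU hsolve hinit hemp _ t).trans ?_
      have := mul_le_mul_of_nonneg_right (Nat.cast_le (α := ℝ).2 htF) m.costU_nonneg
      linarith

end RegretBounds

/-! ### Matching the constants of the statement. -/

section Numerics

/-- The numerical estimate for the sampling regret: `q` is the number of initial periods plus the
expected number of periods with a bad content. -/
lemma sampling_numeric {F γ L gi Δ r q : ℝ} (hF : 0 ≤ F) (hγ : 2 ≤ γ) (hΔ : 0 ≤ Δ)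
    (hq : q ≤ F + (F * (6 * L / gi ^ 2 + (γ * r + 1))
      + 2 * F * ((γ + 1) * (Real.pi ^ 2 / 6)))) :
    Δ * q ≤ L * (6 / gi ^ 2 * (F * Δ)) + r * (F * Δ * γ)
      + (Real.pi ^ 2 / 3 + 4.12 * γ + 1) * F * Δ := by
  have hpi : Real.pi ^ 2 ≤ 9.93 := by nlinarith [Real.pi_lt_d2, Real.pi_pos]
  have h1 := mul_le_mul_of_nonneg_left hq hΔ
  have h2 : 0 ≤ F * Δ := mul_nonneg hF hΔ
  -- The `1` comes from rounding block lengths up; it is at most `γ / 2`, and `π²/3 + 1/2 < 4.12`.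
  have h3 : 1 + γ * (Real.pi ^ 2 / 3) ≤ 4.12 * γ := by nlinarith
  have h4 := mul_le_mul_of_nonneg_left h3 h2
  have h5 : Δ * (F + (F * (6 * L / gi ^ 2 + (γ * r + 1)) + 2 * F * ((γ + 1) * (Real.pi ^ 2 / 6))))
      = L * (6 / gi ^ 2 * (F * Δ)) + r * (F * Δ * γ) + (F * Δ) * (1 + γ * (Real.pi ^ 2 / 3))
        + F * Δ * (1 + Real.pi ^ 2 / 3) := by ring
  linarith

/-- The numerical estimate for the switching regret. -/
lemma switching_numeric {F γ L gi Mu Ml r J β Q δ X Y S : ℝ} (hF : 0 ≤ F) (hFF : F ≤ F ^ 2)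
    (hγ : 2 ≤ γ) (hL : 0 ≤ L) (hMl : 0 ≤ Ml) (hM : Ml ≤ Mu) (hJ : J + 1 ≤ r) (hβ : β ≤ 1)
    (hδ : 1 ≤ δ) (hX : 0 ≤ X) (hY : 0 ≤ Y)
    (hQ : Q ≤ F * (6 * L / gi ^ 2 + δ - 1) / δ + 2 * F * (Real.pi ^ 2 / 6))
    (hS : S ≤ F * Mu + J * Ml + (Mu - Ml) * (2 * Q + 2 * J * (1 - β))) :
    S ≤ L * (6 / gi ^ 2 * (2 * F * (Mu - Ml)) + γ / 2 * (2 * F * (Mu - Ml)))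
      + r * (Mu + (Mu - Ml) * (1 - 2 * β))
      + (F * (X + 1 + Real.pi ^ 2 / 6 + γ + Y - 1 / δ) * (2 * F * (Mu - Ml)) + F * Mu - Ml) := by
  have hE : 0 ≤ Mu - Ml := by linarith
  have hpi : Real.pi ^ 2 ≤ 9.93 := by nlinarith [Real.pi_lt_d2, Real.pi_pos]
  have hδ1 : 1 / δ ≤ 1 := by rwa [div_le_one (by linarith)]
  have hℓ : 0 ≤ 6 * L / gi ^ 2 := by positivity
  have hQ' : Q ≤ F * (6 * L / gi ^ 2) + F ^ 2 * (1 - 1 / δ)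
      + F ^ 2 * (Real.pi ^ 2 / 6 + γ) := by
    have e : F * (6 * L / gi ^ 2 + δ - 1) / δ
        = F * (6 * L / gi ^ 2) * (1 / δ) + F * (1 - 1 / δ) := by
      field_simp
      ring
    rw [e] at hQ
    have h1 : F * (6 * L / gi ^ 2) * (1 / δ) ≤ F * (6 * L / gi ^ 2) :=
      mul_le_of_le_one_right (by positivity) hδ1
    have h2 : F * (1 - 1 / δ) ≤ F ^ 2 * (1 - 1 / δ) :=
      mul_le_mul_of_nonneg_right hFF (by linarith)
    have h3 : F * (Real.pi ^ 2 / 6 + γ) ≤ F ^ 2 * (Real.pi ^ 2 / 6 + γ) :=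
      mul_le_mul_of_nonneg_right hFF (by positivity)
    have h4 : F * (Real.pi ^ 2 / 6) ≤ F * γ := mul_le_mul_of_nonneg_left (by linarith) hF
    linarith
  have h5 := mul_le_mul_of_nonneg_left hQ' (mul_nonneg zero_le_two hE)
  -- The coefficient of `√t` equals `Ml + 2 (1 - β) (Mu - Ml)`. Using `J + 1 ≤ r` instead of `J ≤ r`
  -- leaves the term `-Ml` of the constant.
  have h6 : (J + 1) * (Ml + 2 * (1 - β) * (Mu - Ml)) ≤ r * (Ml + 2 * (1 - β) * (Mu - Ml)) :=
    mul_le_mul_of_nonneg_right hJ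
      (add_nonneg hMl (mul_nonneg (mul_nonneg zero_le_two (by linarith)) hE))
  have h7 : 0 ≤ (1 - β) * (Mu - Ml) := mul_nonneg (by linarith) hE
  have h8 : 0 ≤ L * (γ / 2 * (2 * F * (Mu - Ml))) := by positivity
  have h9 : 0 ≤ F * (X + Y) * (2 * F * (Mu - Ml)) := by positivity
  have e2 : L * (6 / gi ^ 2 * (2 * F * (Mu - Ml)) + γ / 2 * (2 * F * (Mu - Ml)))
      + r * (Mu + (Mu - Ml) * (1 - 2 * β))
      + (F * (X + 1 + Real.pi ^ 2 / 6 + γ + Y - 1 / δ) * (2 * F * (Mu - Ml)) + F * Mu - Ml)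
      = 2 * (Mu - Ml) * (F * (6 * L / gi ^ 2) + F ^ 2 * (1 - 1 / δ)
        + F ^ 2 * (Real.pi ^ 2 / 6 + γ)) + L * (γ / 2 * (2 * F * (Mu - Ml)))
        + F * (X + Y) * (2 * F * (Mu - Ml)) + r * (Ml + 2 * (1 - β) * (Mu - Ml))
        + F * Mu - Ml := by ring
  rw [e2]
  nlinarith

/-- A bound of the form `a log t + b √t + c` is `O(√t)`. -/
lemma exists_le_mul_sqrt {R : ℕ → ℝ} {a b c : ℝ}
    (h : ∀ t : ℕ, 1 ≤ t → R t ≤ Real.log t * a + √(t : ℝ) * b + c) :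
    ∃ K : ℝ, ∀ t : ℕ, 1 ≤ t → R t ≤ K * √(t : ℝ) := by
  refine ⟨2 * |a| + b + |c|, fun t ht => (h t ht).trans ?_⟩
  have ht' : (1 : ℝ) ≤ t := by exact_mod_cast ht
  have h1 : 1 ≤ √(t : ℝ) := Real.one_le_sqrt.2 ht'
  have h2 : Real.log t ≤ 2 * √(t : ℝ) := by
    have := Real.log_le_sub_one_of_pos (by linarith : 0 < √(t : ℝ))
    rw [Real.log_sqrt (by linarith)] at this
    linarith
  have h3 : Real.log t * a ≤ 2 * √(t : ℝ) * |a| :=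
    (mul_le_mul_of_nonneg_left (le_abs_self a) (Real.log_nonneg ht')).trans
      (mul_le_mul_of_nonneg_right h2 (abs_nonneg a))
  have h4 : c ≤ √(t : ℝ) * |c| :=
    (le_abs_self c).trans (le_mul_of_one_le_left (abs_nonneg c) h1)
  linarith

end Numerics

/-! ### The regret bound. -/

theorem theorem1 {F : ℕ} (m : CacheModel F)
    {Ω Seed : Type*} [MeasurableSpace Ω] [MeasurableSpace Seed]
    (P : Measure Ω) [IsProbabilityMeasure P] (ν : Measure Seed) [IsProbabilityMeasure ν]
    (θ : Fin F → ℝ) (d : ℕ → Ω → Fin F → ℝ) (ξ : ℕ → Ω → Seed)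
    (henv : IsEnvironment P ν θ d ξ)
    (α β : ℝ) (hα : α ∈ Set.Icc (0 : ℝ) 1) (hβ : β ∈ Set.Icc (0 : ℝ) 1)
    (solve : (Fin F → ℝ) → Seed → Finset (Fin F)) (hsolve : m.IsSolver α β ν solve)
    (init : ℕ → Finset (Fin F)) (hinit : m.IsInit init)
    (hbad : (m.bad α θ).Nonempty)
    (g : ℝ ≃ₗ[ℝ] ℝ) (hg : m.IsRewardModulus g)
    (w : ℝ) (hw : 0 ≤ w)
    (γ : ℝ) (hγl : 2 + 1 / √((F : ℝ) + 1) ≤ γ)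
    (hγu : γ ≤ ((F : ℝ) ^ 2 + F - 1) / √((F : ℝ) + 1))
    (𝓜 : ℕ → Ω → Finset (Fin F))
    (h𝓜 : ∀ t ω, 𝓜 t ω =
      (cucbsc (switchTime F γ) init solve (fun i => d i ω) (fun i => ξ i ω) t).cache)
    (Δu Δl Mu Ml C : ℝ)
    (hΔu : Δu = m.gapU α θ) (hΔl : Δl = m.gapL α θ)
    (hMu : Mu = m.costU) (hMl : Ml = m.costL α θ)
    (hC : C = regretConst F γ (g.symm Δl) Mu Ml) :
    (∀ t : ℕ, 1 ≤ t →
      regret m P θ α β 𝓜 w t ≤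
        Real.log t * (6 / (g.symm Δl) ^ 2 * (2 * F * w * (Mu - Ml) + F * Δu)
          + w * (γ / 2) * (2 * F * (Mu - Ml)))
        + √(t : ℝ) * (w * Mu + w * (Mu - Ml) * (1 - 2 * β) + F * Δu * γ)
        + (Real.pi ^ 2 / 3 + 4.12 * γ + 1) * F * Δu + w * C)
    ∧ ∃ K : ℝ, ∀ t : ℕ, 1 ≤ t → regret m P θ α β 𝓜 w t ≤ K * √(t : ℝ) := by
  have hγ2 : 2 ≤ γ := le_trans (by simp) hγl
  -- For `F = 0` the upper bound on `γ` equals `-1`.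
  have hFpos : 0 < F := by
    rcases Nat.eq_zero_or_pos F with rfl | h
    · norm_num at hγu
      linarith
    · exact h
  obtain ⟨B, hB⟩ := hbad
  have hemp : m.Feasible ∅ := hB.1.mono (Finset.empty_subset _)
  have hbad : (m.bad α θ).Nonempty := ⟨B, hB⟩
  -- An initial content that holds some file is feasible and nonempty, which forces `g 1 > 0`.
  have hgpos : 0 < g.symm (m.gapL α θ) := by
    obtain ⟨s, hs, hf⟩ := hinit.2 ⟨0, hFpos⟩
    have h1 := hg.users_mul_sum_size_le (hinit.1 s hs)
    rw [g.symm_apply_eq_div]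
    exact div_pos (m.gapL_pos hbad) (lt_of_lt_of_le (mul_pos m.users_pos
      (Finset.sum_pos (fun f _ => m.size_pos f) ⟨_, hf⟩)) h1)
  obtain rfl : 𝓜 = fun i ω => (cucbRun (switchTime F γ) init solve d ξ i ω).cache := by
    funext i ω
    exact h𝓜 i ω
  have hbound : ∀ t : ℕ, 1 ≤ t →
      regret m P θ α β
        (fun i ω => (cucbRun (switchTime F γ) init solve d ξ i ω).cache) w t ≤
        Real.log t * (6 / (g.symm Δl) ^ 2 * (2 * F * w * (Mu - Ml) + F * Δu)
          + w * (γ / 2) * (2 * F * (Mu - Ml)))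
        + √(t : ℝ) * (w * Mu + w * (Mu - Ml) * (1 - 2 * β) + F * Δu * γ)
        + (Real.pi ^ 2 / 3 + 4.12 * γ + 1) * F * Δu + w * C := by
    intro t ht
    subst hΔu hΔl hMu hMl hC
    obtain ⟨q, hq, hq'⟩ := henv.exists_samplingRegret_le hsolve hinit hemp hα.1 hβ.2 hbad hg hgpos
      hγl t
    have hsamp := hq.trans
      (sampling_numeric (Nat.cast_nonneg F) hγ2 (m.gapU_pos hbad).le hq')
    obtain ⟨J, Q, hJ, hQ, hS⟩ := henv.exists_switchingRegret_le hsolve hinit hemp hα.1 hg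
      hgpos hγl ht
    -- `X` and `Y` are nonnegative slack in the constant; the estimate does not need them beyond
    -- their sign.
    have hsw := switching_numeric
      (X := 6 * F / g.symm (m.gapL α θ) ^ 2 * (Real.log (F + 1) / blockLen γ (F + 1)))
      (Y := (Real.pi ^ 2 / 3 + 4.12 * γ) / blockLen γ (switchTime F γ 1)) (Nat.cast_nonneg F)
      (by exact_mod_cast Nat.le_self_pow two_ne_zero F) hγ2 (Real.log_natCast_nonneg t)
      (m.costL_nonneg α θ) (m.costL_le_costU α θ) hJ hβ.2
      (Nat.one_le_cast.2 (blockLen_switchTime_pos (F := F) (lt_of_lt_of_le two_pos hγ2) 0))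
      (by
        have : 0 ≤ Real.log ((F : ℝ) + 1) := Real.log_nonneg (by simp)
        positivity)
      (by positivity) hQ hS
    have hw' := mul_le_mul_of_nonneg_left hsw hw
    rw [regret, regretConst]
    linarith
  exact ⟨hbound, exists_le_mul_sqrt fun t ht => (hbound t ht).trans_eq (add_assoc _ _ _)⟩
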